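/- Let $\mathbb T=\mathbb R\cup\{\infty\}$ and $\mathbb{TP}^{n-1}=(\mathbb T^n\setminus\{(\infty,\dots,\infty)\})/\mathbb R(1,\dots,1)$. Let $V$ be a valuated matroid of rank $d$ on $[n]=\{1,\dots,n\}$: a vector $(V_B)_{B\in\binom{[n]}d}$ with entries in $\mathbb T$, not all $\infty$, taken up to adding a real constant, such that for all $A\in\binom{[n]}{d-1}$ and $C\in\binom{[n]}{d+1}$ the minimum of $V_{A\cup\{j\}}+V_{C\setminus\{j\}}$ over $j\in C\setminus A$ is attained at more than one $j$. Assume that $V$ is connected, i.e. that its underlying matroid, whose bases are the $B$ with $V_B<\infty$, is connected. Let $$L=L(V)=\Bigl\{y\in\mathbb{TP}^{n-1}:\ \text{for every } C\in\tbinom{[n]}{d+1},\ \min_{j\in C}\,(y_j+V_{C\setminus\{j\}})\text{ is attained at more than one } j\in C\Bigr\}.$$ For $x\in\mathbb R^n$ let $V^x$ be the initial matroid, whose bases are the $B$ minimizing $V_B-\sum_{i\in B}x_i$, and let $\mathcal M(V)$ be the set of all initial matroids whose loops are loops of $V$. For $M\in\mathcal M(V)$ let $\operatorname{relint}(L_M)=\{x\in\mathbb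 R^n: V^x=M\}/\mathbb R(1,\dots,1)$; if $M$ is connected, this is a single point, denoted $v_M$. For $x\in\mathbb R^n$ and $y\in\mathbb{TP}^{n-1}$ let $\operatorname{relsupp}_x(y)$ be the set of the indices $j\in[n]$ at which $y_j-x_j$ does not attain its minimum. Write $\operatorname{cork}_M(F)=d-\operatorname{rk}_M(F)$, and call $F$ a cyclic flat of $M$ if $F$ is a flat of $M$ and $[n]\setminus F$ is a flat of the dual matroid $M^*$. For $F$ a flat of $M$ and $x\in\operatorname{relint}(L_M)$ put $$R_0(F,x,L)=\{y\in L: F\subseteq\operatorname{relsupp}_x(y)\},$$ and if $F$ is a cyclic flat of $M$ put $$R_\infty(F,x,L)=\bigcap_{y\in\operatorname{relint}(L_{M|F\oplus M/F})}R_0(F,y,L).$$ A multiset of $d$ points $A_1,\dots,A_d$ of $\mathbb{TP}^{n-1}$ is a presentation of $V$ if, for a $d\times n$ matrix $a$ whose rows are coordinate vectors of $A_1,\dots,A_d$, the vector of the tropical maximal minors $\min\{\sum_{i=1}^d a_{i,j_i}:\{j_1,\dots,j_d\}=B\}$, $B\in\binom{[n]}d$, equals $V$ up to adding a real constant. **Theorem.**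 Let $A_1,\dots,A_d\in L$. Then $\{\!\{A_1,\dots,A_d\}\!\}$ is a presentation of $V$ if and only if for every connected matroid $M\in\mathcal M(V)$ the following two conditions hold: 1. $|\{i\in[d]: A_i\in R_0(F,v_M,L)\}|\le\operatorname{cork}_M(F)$ for every flat $F$ of $M$; 2. $|\{i\in[d]: A_i\in R_\infty(F,v_M,L)\}|=\operatorname{cork}_M(F)$ for every cyclic flat $F$ of $M$. -/

import Mathlib

open Matroid

noncomputable section

/-- A tropical vector: coordinates in `𝕋 = ℝ ∪ {∞}` (here `WithTop ℝ`, with `⊕ = min`, `⊙ = +`),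
not all equal to `∞`. -/
abbrev TropVec (n : ℕ) : Type := {y : Fin n → WithTop ℝ // ∃ i, y i ≠ ⊤}

/-- Two tropical vectors are identified when they differ by a real multiple of `(1,…,1)`. -/
instance tropVecSetoid (n : ℕ) : Setoid (TropVec n) where
  r y z := ∃ c : ℝ, ∀ i, z.1 i = y.1 i + (c : WithTop ℝ)
  iseqv :=
    { refl := fun y => ⟨0, fun i => by simp⟩
      symm := by
        rintro y z ⟨c, h⟩
        refine ⟨-c, fun i => ?_⟩
        rw [h i, add_assoc, ← WithTop.coe_add]
        simp
      trans := by
        rintro x y z ⟨c, h⟩ ⟨c', h'⟩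
        refine ⟨c + c', fun i => ?_⟩
        rw [h' i, h i, add_assoc, ← WithTop.coe_add] }

/-- Tropical projective space `𝕋ℙ^{n-1}`, with homogeneous coordinates indexed by `Fin n`. -/
abbrev TropProj (n : ℕ) : Type := Quotient (tropVecSetoid n)

/-- The minimum of `f` over the finite set `s` is attained at more than one index of `s`. -/
def MinAttainedTwice {n : ℕ} (s : Finset (Fin n)) (f : Fin n → WithTop ℝ) : Prop :=
  ∃ j₁ ∈ s, ∃ j₂ ∈ s, j₁ ≠ j₂ ∧ ∀ k ∈ s, f j₁ ≤ f k ∧ f j₂ ≤ f k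

/-- A valuated matroid of rank `d` on the ground set `Fin n`, given by a vector of homogeneous
coordinates `V_B`, one for every `d`-subset `B`, not all `∞`, satisfying the tropical Plücker
relations. As a bookkeeping device the coordinate function is defined on all finite sets, with the
fixed value `∞` on those that do not have `d` elements. Two such vectors that differ by a real
constant are coordinates of the same point of tropical projective space. -/
structure ValuatedMatroid (n d : ℕ) where
  val : Finset (Fin n) → WithTop ℝ
  val_eq_top : ∀ B, B.card ≠ d → val B = ⊤
  exists_ne_top : ∃ B, val B ≠ ⊤
  plucker : ∀ A C : Finset (Fin n), A.card + 1 = d → C.card = d + 1 →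
    MinAttainedTwice (C \ A) (fun j => val (insert j A) + val (C.erase j))

/-- The tropical Stiefel map in coordinates: the tropical maximal minor of the `d × n` matrix `a`
with set of columns `B`, that is, the minimum of `∑ i, a i (j i)` over all `j : [d] → [n]`
with `{j 1, …, j d} = B`. -/
def tropicalMinor {n d : ℕ} (a : Fin d → Fin n → WithTop ℝ) (B : Finset (Fin n)) : WithTop ℝ :=
  (Finset.univ.filter (fun j : Fin d → Fin n => Finset.univ.image j = B)).inf
    (fun j => ∑ i, a i (j i))

/-- The relative support of `y` with respect to the point with finite coordinates `x`: the set of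
the indices at which `y - x` does not attain its minimum. -/
def relSupp {n : ℕ} (x : Fin n → ℝ) (p : TropProj n) : Set (Fin n) :=
  Quotient.lift
    (fun y : TropVec n =>
      {j : Fin n | ∃ k, y.1 k + ((-x k : ℝ) : WithTop ℝ) < y.1 j + ((-x j : ℝ) : WithTop ℝ)})
    (by
      rintro y z ⟨c, h⟩
      ext j
      simp only [Set.mem_ofPred_eq]
      refine exists_congr fun k => ?_
      rw [h j, h k, add_right_comm, add_right_comm (y.1 j)]
      exact (WithTop.add_lt_add_iff_right WithTop.coe_ne_top).symm) p

namespace ValuatedMatroid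

variable {n d : ℕ}

/-- The height `V_B - ∑ i ∈ B, x i`. -/
def height (V : ValuatedMatroid n d) (x : Fin n → ℝ) (B : Finset (Fin n)) : WithTop ℝ :=
  V.val B + ((-∑ i ∈ B, x i : ℝ) : WithTop ℝ)

/-- The bases of the initial matroid at `x`: the sets `B` minimizing `V_B - ∑ i ∈ B, x i`. -/
def IsInitialBase (V : ValuatedMatroid n d) (x : Fin n → ℝ) (S : Set (Fin n)) : Prop :=
  ∃ B : Finset (Fin n), (B : Set (Fin n)) = S ∧ V.val B ≠ ⊤ ∧ ∀ B', V.height x B ≤ V.height x B'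

theorem card_of_ne_top (V : ValuatedMatroid n d) {B : Finset (Fin n)} (h : V.val B ≠ ⊤) :
    B.card = d := by
  by_contra hc
  exact h (V.val_eq_top B hc)

/-- The tropical Plücker relations give a symmetric exchange. -/
theorem exists_exchange (V : ValuatedMatroid n d) {X Y : Finset (Fin n)}
    (hX : V.val X ≠ ⊤) (hY : V.val Y ≠ ⊤) {a : Fin n} (haX : a ∈ X) (haY : a ∉ Y) :
    ∃ b ∈ Y, b ∉ X ∧ V.val (insert b (X.erase a)) + V.val ((insert a Y).erase b)
      ≤ V.val X + V.val Y := by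
  have hXc := V.card_of_ne_top hX
  have hYc := V.card_of_ne_top hY
  have h1 : (X.erase a).card + 1 = d := by
    rw [Finset.card_erase_add_one haX, hXc]
  have h2 : (insert a Y).card = d + 1 := by
    rw [Finset.card_insert_of_notMem haY, hYc]
  obtain ⟨j₁, hj₁, j₂, hj₂, hne, hmin⟩ := V.plucker _ _ h1 h2
  have ha : a ∈ insert a Y \ X.erase a := by simp
  have hva : V.val (insert a (X.erase a)) + V.val ((insert a Y).erase a)
      = V.val X + V.val Y := by
    rw [Finset.insert_erase haX, Finset.erase_insert haY]
  have key : ∀ j, j ≠ a → j ∈ insert a Y \ X.erase a → j ∈ Y ∧ j ∉ X := by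
    intro j hja hj
    simp only [Finset.mem_sdiff, Finset.mem_insert, Finset.mem_erase] at hj
    tauto
  by_cases hj : j₁ = a
  · have hj2 : j₂ ≠ a := fun h => hne (hj.trans h.symm)
    exact ⟨j₂, (key j₂ hj2 hj₂).1, (key j₂ hj2 hj₂).2, hva ▸ (hmin a ha).2⟩
  · exact ⟨j₁, (key j₁ hj hj₁).1, (key j₁ hj hj₁).2, hva ▸ (hmin a ha).1⟩

theorem exists_isInitialBase (V : ValuatedMatroid n d) (x : Fin n → ℝ) :
    ∃ S, V.IsInitialBase x S := by
  obtain ⟨B, -, hB⟩ := Finset.exists_min_image (Finset.univ : Finset (Finset (Fin n)))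
    (V.height x) Finset.univ_nonempty
  refine ⟨B, B, rfl, fun h => ?_, fun B' => hB B' (Finset.mem_univ _)⟩
  obtain ⟨B₀, hB₀⟩ := V.exists_ne_top
  have := hB B₀ (Finset.mem_univ _)
  simp only [height, h, top_add, top_le_iff, WithTop.add_eq_top, WithTop.coe_ne_top,
    or_false] at this
  exact hB₀ this

theorem isInitialBase_exchange (V : ValuatedMatroid n d) (x : Fin n → ℝ) :
    Matroid.ExchangeProperty (V.IsInitialBase x) := by
  rintro _ _ ⟨X, rfl, hX, hXm⟩ ⟨Y, rfl, hY, hYm⟩ a ⟨haX, haY⟩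
  simp only [Finset.mem_coe] at haX haY
  obtain ⟨b, hbY, hbX, hle⟩ := V.exists_exchange hX hY haX haY
  have hab : b ≠ a := by rintro rfl; exact haY hbY
  have hXY : V.val X + V.val Y ≠ ⊤ := WithTop.add_ne_top.2 ⟨hX, hY⟩
  obtain ⟨h1, h2⟩ := WithTop.add_ne_top.1 (ne_top_of_le_ne_top hXY hle)
  have hsum : ∑ i ∈ insert b (X.erase a), x i + ∑ i ∈ (insert a Y).erase b, x i
      = ∑ i ∈ X, x i + ∑ i ∈ Y, x i := by
    have e1 : ∑ i ∈ insert b (X.erase a), x i = x b + ∑ i ∈ X.erase a, x i :=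
      Finset.sum_insert (by simp [hbX])
    have e2 := Finset.add_sum_erase X x haX
    have e3 := Finset.add_sum_erase (insert a Y) x (a := b) (by simp [hbY])
    have e4 : ∑ i ∈ insert a Y, x i = x a + ∑ i ∈ Y, x i := Finset.sum_insert haY
    linarith
  refine ⟨b, ⟨hbY, hbX⟩, insert b (X.erase a), by simp, h1, fun B' => (?_ : _ ≤ _).trans (hXm B')⟩
  have hY' := hYm ((insert a Y).erase b)
  simp only [height] at hY' ⊢
  obtain ⟨p, hp⟩ := WithTop.ne_top_iff_exists.1 hX
  obtain ⟨q, hq⟩ := WithTop.ne_top_iff_exists.1 hY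
  obtain ⟨r, hr⟩ := WithTop.ne_top_iff_exists.1 h1
  obtain ⟨s, hs⟩ := WithTop.ne_top_iff_exists.1 h2
  rw [← hp, ← hq, ← hr, ← hs] at hle
  rw [← hq, ← hs] at hY'
  rw [← hp, ← hr]
  norm_cast at hle hY' ⊢
  linarith

/-- The initial matroid `V^x`. -/
def initial (V : ValuatedMatroid n d) (x : Fin n → ℝ) : Matroid (Fin n) :=
  Matroid.ofIsBaseOfFinite (E := Set.univ) Set.finite_univ (V.IsInitialBase x)
    (V.exists_isInitialBase x) (V.isInitialBase_exchange x) (fun _ _ => Set.subset_univ _)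

/-- The matroid underlying `V`, whose bases are the sets `B` with `V_B` finite. -/
def underlying (V : ValuatedMatroid n d) : Matroid (Fin n) :=
  Matroid.ofIsBaseOfFinite (E := Set.univ) Set.finite_univ
    (fun S => ∃ B : Finset (Fin n), (B : Set (Fin n)) = S ∧ V.val B ≠ ⊤)
    (by
      obtain ⟨B, hB⟩ := V.exists_ne_top
      exact ⟨B, B, rfl, hB⟩)
    (by
      rintro _ _ ⟨X, rfl, hX⟩ ⟨Y, rfl, hY⟩ a ⟨haX, haY⟩
      simp only [Finset.mem_coe] at haX haY
      obtain ⟨b, hbY, hbX, hle⟩ := V.exists_exchange hX hY haX haY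
      have hXY : V.val X + V.val Y ≠ ⊤ := WithTop.add_ne_top.2 ⟨hX, hY⟩
      obtain ⟨h1, -⟩ := WithTop.add_ne_top.1 (ne_top_of_le_ne_top hXY hle)
      exact ⟨b, ⟨hbY, hbX⟩, insert b (X.erase a), by simp, h1⟩)
    (fun _ _ => Set.subset_univ _)

/-- `𝓜(V)`: the initial matroids of `V` all of whose loops are loops in `V`. -/
def initialMatroids (V : ValuatedMatroid n d) : Set (Matroid (Fin n)) :=
  {M | (∃ x, V.initial x = M) ∧ M.loops ⊆ V.underlying.loops}

/-- The tropical linear space `L(V)` in tropical projective space. -/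
def linearSpace (V : ValuatedMatroid n d) : Set (TropProj n) :=
  {p | ∀ y : TropVec n, Quotient.mk _ y = p → ∀ C : Finset (Fin n), C.card = d + 1 →
    MinAttainedTwice C (fun j => y.1 j + V.val (C.erase j))}

/-- The relative interior of the cell `L_M` (points on the faces at infinity are excluded), in
affine coordinates: the set of the `x ∈ ℝⁿ` whose initial matroid is `M`. It is invariant under
adding multiples of `(1,…,1)`. If `M` is connected, it is a single point up to such
multiples: the vertex `v_M`. -/
def relintCell (V : ValuatedMatroid n d) (M : Matroid (Fin n)) : Set (Fin n → ℝ) :=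
  {x | V.initial x = M}

/-- The region `R_0(F, x, L)`. -/
def regionZero (V : ValuatedMatroid n d) (F : Set (Fin n)) (x : Fin n → ℝ) : Set (TropProj n) :=
  {p | p ∈ V.linearSpace ∧ F ⊆ relSupp x p}

end ValuatedMatroid

/-- The matroid `M|F ⊕ M/F`. -/
def restrictSumContract {α : Type*} (M : Matroid α) (F : Set α) : Matroid α :=
  (M ↾ F).disjointSum (M ／ F) (by
    simpa using Set.disjoint_sdiff_right)

/-- A matroid is connected if it is not empty and any two distinct elements of its ground set lie in
a common circuit. -/
def MatroidConnected {α : Type*} (M : Matroid α) : Prop :=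
  M.E.Nonempty ∧ ∀ e ∈ M.E, ∀ f ∈ M.E, e ≠ f → ∃ C, M.IsCircuit C ∧ e ∈ C ∧ f ∈ C

/-- A cyclic flat: a flat of `M` whose complement is a flat of the dual. -/
def IsCyclicFlat {α : Type*} (M : Matroid α) (F : Set α) : Prop :=
  M.IsFlat F ∧ M✶.IsFlat (M.E \ F)

/-- The corank `cork_M(F) = rk(M) - rk_M(F)`. -/
def matroidCorank {α : Type*} (M : Matroid α) (F : Set α) : ℕ∞ := M.eRank - M.eRk F

namespace ValuatedMatroid

variable {n d : ℕ}

/-- The region `R_∞(F, v_M, L)`: the intersection of the regions `R_0(F, y, L)` over all `y` in the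
relative interior of the cell `L_{M|F ⊕ M/F}`. -/
def regionInfty (V : ValuatedMatroid n d) (F : Set (Fin n)) (M : Matroid (Fin n)) :
    Set (TropProj n) :=
  ⋂ y ∈ V.relintCell (restrictSumContract M F), V.regionZero F y

/-- A multiset `P` of `d` points is a presentation of `V` if, for coordinate vectors `a 1, …, a d` of
its elements, the vector of the tropical maximal minors of the matrix with rows `a 1, …, a d` and
the vector `V` are the same point of tropical projective space. -/
def IsPresentation (V : ValuatedMatroid n d) (P : Multiset (TropProj n)) : Prop :=
  ∃ a : Fin d → TropVec n,
    P = Finset.univ.val.map (fun i => (Quotient.mk _ (a i) : TropProj n)) ∧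
    ∃ c : ℝ, ∀ B : Finset (Fin n), B.card = d →
      tropicalMinor (fun i => (a i).1) B = V.val B + (c : WithTop ℝ)

end ValuatedMatroid

/-- The number of the indices `i` such that the point `A i` lies in the region `R`. -/
def countIn {n d : ℕ} (A : Fin d → TropProj n) (R : Set (TropProj n)) : ℕ∞ :=
  {i | A i ∈ R}.encard

end

noncomputable section

/-! ### Matroid preliminaries -/

section MatroidLemmas

variable {α : Type*} {M : Matroid α} {F B : Set α} {e f g : α}

/-! Necessity. Subtract x from the rows. For a presentation, a cheapest matching of the rows with a
base B of V^x is cheapest among all injective choices of columns. If V^x has no coloop, every column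
is avoided by another optimal matching, and an alternating path (`le_of_optimal_assignment`) shows
that each row is matched to one of its minimal entries, i.e. outside its relative support. A base
with |B \ F| = cork(F) then gives condition 1. The bases of M|F ⊕ M/F are the bases of M that meet F
in a basis of F. For a cyclic flat F of a connected M on at least two elements this sum has no
coloop, so the same argument on its whole cell puts the cork(F) rows matched outside F into R_∞; the
other inequality follows from R_∞ ⊆ R_0.

Sufficiency. Relative supports of points of L are flats (`isFlat_relSupp`), so condition 1 yields
Hall's condition for matching the rows with a base of V^v through row-minimal entries. Hence the
minors agree with V on the bases of V^v up to a constant. Two bases that differ by an exchange lie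
in a common connected initial matroid, so all these constants agree. A non-base C contains a circuit
D, whose closure F is a cyclic flat of the underlying matroid and, with the same rank, of some
connected V^v (`exists_connected_isCyclicFlat`). There every point of R_∞ is ∞ on F, so by condition
2 a finite matching with C sends at least cork(F) rows outside F. This leaves at most rk(F) = |D| -
1 columns of C in F, although D ⊆ C ∩ F; so the minor at C is ∞. -/

theorem restrictSumContract_isBase_iff (hF : F ⊆ M.E) :
    (restrictSumContract M F).IsBase B ↔ M.IsBase B ∧ M.IsBasis (B ∩ F) F := by
  rw [restrictSumContract, disjointSum_isBase_iff, restrict_ground_eq, contract_ground,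
    isBase_restrict_iff hF]
  constructor
  · rintro ⟨hJ, hK, hB⟩
    rw [Set.union_sdiff_cancel hF] at hB
    have hKF : B ∩ (M.E \ F) = B \ F := by
      rw [← Set.inter_sdiff_assoc, Set.inter_eq_self_of_subset_left hB]
    rw [hKF] at hK
    refine ⟨?_, hJ⟩
    have hBi : M.Indep B := by
      have := (hJ.contract_indep_iff.1 hK.indep).1
      rwa [Set.union_comm, Set.inter_union_sdiff] at this
    refine isBase_iff_maximal_indep.2 ⟨hBi, fun B' hB' hBB' x hx => ?_⟩
    by_cases hxF : x ∈ F
    · have : B ∩ F = B' ∩ F := hJ.eq_of_subset_indep (hB'.subset Set.inter_subset_left)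
        (Set.inter_subset_inter_left _ hBB') Set.inter_subset_right
      exact (this.symm.subset ⟨hx, hxF⟩).1
    · have hi : (M ／ F).Indep (B' \ F) := by
        rw [hJ.contract_indep_iff]
        exact ⟨hB'.subset (Set.union_subset Set.sdiff_subset
          (Set.inter_subset_left.trans hBB')), Set.disjoint_sdiff_right⟩
      have := hK.eq_of_subset_indep hi (Set.sdiff_subset_sdiff_left hBB')
      exact (this.symm.subset ⟨hx, hxF⟩).1
  · rintro ⟨hB, hJ⟩
    refine ⟨hJ, ?_, by rw [Set.union_sdiff_cancel hF]; exact hB.subset_ground⟩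
    have hKF : B ∩ (M.E \ F) = B \ F := by
      rw [← Set.inter_sdiff_assoc, Set.inter_eq_self_of_subset_left hB.subset_ground]
    rw [hKF]
    refine isBase_iff_maximal_indep.2 ⟨?_, fun K hK hBK x hx => ?_⟩
    · rw [hJ.contract_indep_iff]
      refine ⟨?_, Set.disjoint_sdiff_right⟩
      rw [Set.union_comm, Set.inter_union_sdiff]
      exact hB.indep
    · obtain ⟨h1, h2⟩ := hJ.contract_indep_iff.1 hK
      have h3 : B = K ∪ B ∩ F := hB.eq_of_subset_indep h1 (by
        rw [← Set.inter_union_sdiff B F]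
        refine Set.union_subset ?_ ?_
        · rw [Set.inter_union_sdiff]; exact Set.subset_union_right
        · exact hBK.trans Set.subset_union_left)
      exact ⟨h3.symm.subset (Or.inl hx), fun hxF => Set.disjoint_left.1 h2 hxF hx⟩

theorem restrictSumContract_ground (hF : F ⊆ M.E) : (restrictSumContract M F).E = M.E := by
  simp [restrictSumContract, Set.union_eq_self_of_subset_left hF]

/-- A basis of F \ {e} still spans F and extends inside `M.E \ {e}` to a base of M. Thus e is no
coloop of M|F ⊕ M/F. -/
theorem exists_isBase_notMem_inter_isBasis (hF : F ⊆ M.E) (he : e ∈ M.closure (M.E \ {e}))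
    (heF : e ∈ F → e ∈ M.closure (F \ {e})) :
    ∃ B, M.IsBase B ∧ M.IsBasis (B ∩ F) F ∧ e ∉ B := by
  obtain ⟨J, hJ⟩ := M.exists_isBasis (F \ {e}) (Set.sdiff_subset.trans hF)
  have hJF : M.IsBasis J F := by
    rw [isBasis_iff_indep_closure]
    refine ⟨hJ.indep, fun x hx => ?_, hJ.subset.trans Set.sdiff_subset⟩
    rw [hJ.closure_eq_closure]
    by_cases hxe : x = e
    · subst hxe; exact heF hx
    · exact M.subset_closure (F \ {e}) (Set.sdiff_subset.trans hF) ⟨hx, hxe⟩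
  obtain ⟨B, hB, hJB⟩ := hJ.indep.subset_isBasis_of_subset
    (hJ.subset.trans (Set.sdiff_subset_sdiff_left hF)) Set.sdiff_subset
  have hBB : M.IsBase B := by
    refine hB.indep.isBase_of_ground_subset_closure fun x hx => ?_
    rw [hB.closure_eq_closure]
    by_cases hxe : x = e
    · subst hxe; exact he
    · exact M.subset_closure (M.E \ {e}) Set.sdiff_subset ⟨hx, hxe⟩
  refine ⟨B, hBB, ?_, fun h => (hB.subset h).2 rfl⟩
  rwa [← hJF.eq_of_subset_indep (hBB.indep.subset Set.inter_subset_left)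
    (Set.subset_inter hJB hJF.subset) Set.inter_subset_right]

theorem exists_isBase_inter_isBasis (hF : F ⊆ M.E) :
    ∃ B, M.IsBase B ∧ M.IsBasis (B ∩ F) F := by
  obtain ⟨J, hJ⟩ := M.exists_isBasis F hF
  obtain ⟨B, hB, hJB⟩ := hJ.indep.exists_isBase_superset
  refine ⟨B, hB, ?_⟩
  rwa [← hJ.eq_of_subset_indep (hB.indep.subset Set.inter_subset_left)
    (Set.subset_inter hJB hJ.subset) Set.inter_subset_right]

theorem isFlat_iff_exists_isBase (hF : F ⊆ M.E) :
    M.IsFlat F ↔ ∀ e ∈ M.E \ F, ∃ B, M.IsBase B ∧ M.IsBasis (B ∩ F) F ∧ e ∈ B := by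
  constructor
  · rintro h e ⟨heE, heF⟩
    obtain ⟨J, hJ⟩ := M.exists_isBasis F hF
    have hcl : e ∉ M.closure J := by rwa [hJ.closure_eq_closure, h.closure]
    have hi : M.Indep (insert e J) := hJ.indep.insert_indep_iff.2 (Or.inl ⟨heE, hcl⟩)
    obtain ⟨B, hB, hJB⟩ := hi.exists_isBase_superset
    refine ⟨B, hB, ?_, hJB (Set.mem_insert _ _)⟩
    rwa [← hJ.eq_of_subset_indep (hB.indep.subset Set.inter_subset_left)
      (Set.subset_inter ((Set.subset_insert _ _).trans hJB) hJ.subset) Set.inter_subset_right]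
  · intro h
    rw [isFlat_iff_closure_eq]
    refine Set.Subset.antisymm (fun e he => ?_) (M.subset_closure F hF)
    by_contra heF
    obtain ⟨B, hB, hJ, heB⟩ := h e ⟨M.closure_subset_ground F he, heF⟩
    rw [← hJ.closure_eq_closure] at he
    have hsub : B ∩ F ⊆ B \ {e} := fun x hx => ⟨hx.1, fun hxe => heF (hxe ▸ hx.2)⟩
    exact hB.indep.notMem_closure_sdiff_of_mem heB (M.closure_subset_closure hsub he)

/-- Both flatness conditions become conditions on the bases of M|F ⊕ M/F: no loops outside F, no
coloops inside F. In this form they can be carried from the underlying matroid to an initial one. -/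
theorem isCyclicFlat_iff_exists_isBase (hF : F ⊆ M.E) :
    IsCyclicFlat M F ↔
      (∀ e ∈ M.E \ F, ∃ B, M.IsBase B ∧ M.IsBasis (B ∩ F) F ∧ e ∈ B) ∧
      (∀ e ∈ F, ∃ B, M.IsBase B ∧ M.IsBasis (B ∩ F) F ∧ e ∉ B) := by
  rw [IsCyclicFlat, isFlat_iff_exists_isBase hF, isFlat_iff_exists_isBase
    (by simp : M.E \ F ⊆ M✶.E)]
  refine and_congr_right fun _ => ?_
  simp only [dual_ground, Set.sdiff_sdiff_right_self,
    Set.inter_eq_self_of_subset_right hF]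
  refine forall₂_congr fun e he => ?_
  constructor
  · rintro ⟨B, hB, hb, heB⟩
    refine ⟨M.E \ B, hB.compl_isBase_of_dual, ?_, fun h => h.2 heB⟩
    rw [hB.compl_isBase_of_dual.inter_isBasis_iff_compl_inter_isBasis_dual hF]
    rwa [Set.sdiff_sdiff_cancel_left (show B ⊆ M.E from hB.subset_ground)]
  · rintro ⟨B, hB, hb, heB⟩
    exact ⟨M.E \ B, hB.compl_isBase_dual,
      (hB.inter_isBasis_iff_compl_inter_isBasis_dual hF).1 hb, hF he, heB⟩

/-- Induction on the size of C₁ ∪ C₂. Eliminating a common element f twice gives C₃ through e and C₄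
through g; either C₃, C₂ or C₃, C₄ is an intersecting pair with smaller union. -/
theorem exists_isCircuit_mem_trans [M.Finite] {C₁ C₂ : Set α}
    (h₁ : M.IsCircuit C₁) (h₂ : M.IsCircuit C₂) (he : e ∈ C₁) (hg : g ∈ C₂)
    (hne : (C₁ ∩ C₂).Nonempty) : ∃ C, M.IsCircuit C ∧ e ∈ C ∧ g ∈ C := by
  have hfin : ∀ {C : Set α}, M.IsCircuit C → C.Finite :=
    fun hC => M.ground_finite.subset hC.subset_ground
  by_contra hcon
  push Not at hcon
  induction hN : (C₁ ∪ C₂).ncard using Nat.strong_induction_on generalizing C₁ C₂ with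
  | _ N ih =>
  subst hN
  have hU : (C₁ ∪ C₂).Finite := (hfin h₁).union (hfin h₂)
  obtain ⟨f, hf₁, hf₂⟩ := hne
  obtain ⟨C₃, hs₃, h₃, he₃⟩ := h₁.strong_elimination h₂ hf₁ hf₂ he
    (fun h => hcon _ h₂ h hg)
  obtain ⟨C₄, hs₄, h₄, hg₄⟩ := h₂.strong_elimination h₁ hf₂ hf₁ hg
    (fun h => hcon _ h₁ he h)
  rw [Set.union_comm] at hs₄
  have hn₃ : ¬ C₃ ⊆ C₁ := fun h => (hs₃ ((h₃.eq_of_subset_isCircuit h₁ h).symm ▸ hf₁)).2 rfl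
  have hn₄ : ¬ C₄ ⊆ C₂ := fun h => (hs₄ ((h₄.eq_of_subset_isCircuit h₂ h).symm ▸ hf₂)).2 rfl
  obtain ⟨a, ha₃, ha₁⟩ := Set.not_subset.1 hn₃
  obtain ⟨b, hb₄, hb₂⟩ := Set.not_subset.1 hn₄
  have ha₂ : a ∈ C₂ := (hs₃ ha₃).1.resolve_left ha₁
  have hb₁ : b ∈ C₁ := (hs₄ hb₄).1.resolve_right hb₂
  -- Otherwise C₃, C₂ is a smaller pair. Equality puts all of C₁ \ C₂ into C₃, so C₃ meets C₄ in
  -- `b`, and C₃ ∪ C₄ omits f.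
  have hsub : C₃ ∪ C₂ = C₁ ∪ C₂ := by
    by_contra hne
    refine ih _ (Set.ncard_lt_ncard (lt_of_le_of_ne ?_ hne) hU) h₃ h₂ he₃ hg ⟨a, ha₃, ha₂⟩ rfl
    exact Set.union_subset (hs₃.trans Set.sdiff_subset) Set.subset_union_right
  have hb₃ : b ∈ C₃ := ((hsub.symm.subset (Or.inl hb₁))).resolve_right hb₂
  refine ih _ (Set.ncard_lt_ncard ?_ hU) h₃ h₄ he₃ hg₄ ⟨b, hb₃, hb₄⟩ rfl
  refine ⟨Set.union_subset (hs₃.trans Set.sdiff_subset) (hs₄.trans Set.sdiff_subset), fun h => ?_⟩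
  rcases h (Or.inl hf₁) with h | h
  · exact (hs₃ h).2 rfl
  · exact (hs₄ h).2 rfl

theorem isBase_induction_exchange [M.Finite] {β : Type*} (φ : Set α → β)
    (h : ∀ B a b, M.IsBase B → a ∈ B → b ∉ B → M.IsBase (insert b (B \ {a})) →
      φ B = φ (insert b (B \ {a}))) {B B' : Set α} (hB : M.IsBase B) (hB' : M.IsBase B') :
    φ B = φ B' := by
  induction hN : (B \ B').ncard using Nat.strong_induction_on generalizing B with
  | _ N ih =>
  subst hN
  have hfin : (B \ B').Finite := (M.ground_finite.subset hB.subset_ground).subset Set.sdiff_subset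
  by_cases hsub : B ⊆ B'
  · rw [hB.eq_of_subset_isBase hB' hsub]
  obtain ⟨a, ha, ha'⟩ := Set.not_subset.1 hsub
  obtain ⟨b, hb, hBb⟩ := hB.exchange hB' ⟨ha, ha'⟩
  rw [h B a b hB ha hb.2 hBb]
  refine ih _ (Set.ncard_lt_ncard ⟨?_, fun h => ?_⟩ hfin) hBb rfl
  · rintro x ⟨hx | hx, hx'⟩
    · exact absurd (hx ▸ hb.1) hx'
    · exact ⟨hx.1, hx'⟩
  · rcases (h ⟨ha, ha'⟩).1 with h | h
    · exact hb.2 (h ▸ ha)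
    · exact h.2 rfl

theorem Matroid.IsCircuit.exists_isBase_exchange {C : Set α} (hC : M.IsCircuit C) (he : e ∈ C)
    (hf : f ∈ C) (hef : e ≠ f) :
    ∃ B, M.IsBase B ∧ f ∈ B ∧ e ∉ B ∧ M.IsBase (insert e (B \ {f})) := by
  obtain ⟨B, hB, hCB⟩ := (hC.sdiff_singleton_indep he).exists_isBase_superset
  have heB : e ∉ B := fun h => hC.not_indep (hB.indep.subset fun x hx => by
    by_cases hxe : x = e
    · exact hxe ▸ h
    · exact hCB ⟨hx, hxe⟩)
  refine ⟨B, hB, hCB ⟨hf, hef.symm⟩, heB, ?_⟩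
  have hCsub : C ⊆ insert e B := fun x hx => by
    by_cases hxe : x = e
    · exact Or.inl hxe
    · exact Or.inr (hCB ⟨hx, hxe⟩)
  have hCeq := hC.eq_fundCircuit_of_subset hB.indep hCsub
  have heE := hC.subset_ground he
  have := (hB.indep.mem_fundCircuit_iff (hB.closure_eq.symm ▸ heE) heB).1 (hCeq ▸ hf)
  rw [Set.insert_sdiff_singleton_comm hef]
  exact hB.exchange_isBase_of_indep' (hCB ⟨hf, hef.symm⟩) heB this

/-- A circuit through e ∈ S and f ∉ S gives a base in which f can be replaced by e, which raises |B
∩ S| by one. -/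
theorem mem_iff_of_forall_ncard_inter_eq [M.Finite] (hM : MatroidConnected M) {S : Set α}
    (h : ∀ B B', M.IsBase B → M.IsBase B' → (B ∩ S).ncard = (B' ∩ S).ncard)
    (he : e ∈ M.E) (hf : f ∈ M.E) (heS : e ∈ S) : f ∈ S := by
  by_contra hfS
  have hef : e ≠ f := fun h => hfS (h ▸ heS)
  obtain ⟨C, hC, heC, hfC⟩ := hM.2 e he f hf hef
  obtain ⟨B, hB, hfB, heB, hB'⟩ := hC.exists_isBase_exchange heC hfC hef
  have := h _ _ hB hB'
  have hins : insert e (B \ {f}) ∩ S = insert e (B ∩ S) := by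
    ext x
    simp only [Set.mem_inter_iff, Set.mem_insert_iff, Set.mem_sdiff, Set.mem_singleton_iff]
    constructor
    · rintro ⟨rfl | hx, hxS⟩
      · exact Or.inl rfl
      · exact Or.inr ⟨hx.1, hxS⟩
    · rintro (rfl | hx)
      · exact ⟨Or.inl rfl, heS⟩
      · exact ⟨Or.inr ⟨hx.1, fun hxf => hfS (hxf ▸ hx.2)⟩, hx.2⟩
  rw [hins, Set.ncard_insert_of_notMem (fun h => heB h.1)
    ((M.ground_finite.subset hB.subset_ground).subset Set.inter_subset_left)] at this
  omega

/-- Take for S the component of e. An exchange happens within a fundamental circuit, and both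
exchanged elements lie in S or neither does, so |B ∩ S| is the same for all bases. -/
theorem matroidConnected_of_forall_separator [M.Finite] (hne : M.E.Nonempty)
    (h : ∀ S : Set α, (∀ B B', M.IsBase B → M.IsBase B' → (B ∩ S).ncard = (B' ∩ S).ncard) →
      ∀ e ∈ M.E, ∀ f ∈ M.E, e ∈ S → f ∈ S) : MatroidConnected M := by
  refine ⟨hne, fun e he f hf hef => ?_⟩
  set S : Set α := {g | g = e ∨ ∃ C, M.IsCircuit C ∧ e ∈ C ∧ g ∈ C} with hS
  suffices hsep : f ∈ S from hsep.resolve_left hef.symm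
  refine h S (fun B B' hB hB' => ?_) e he f hf (Or.inl rfl)
  refine isBase_induction_exchange (fun B => (B ∩ S).ncard) (fun B a b hB ha hb hBb => ?_) hB hB'
  have hbE : b ∈ M.E := hBb.subset_ground (Set.mem_insert _ _)
  have hab : b ≠ a := fun h => hb (h ▸ ha)
  have hC := hB.fundCircuit_isCircuit hbE hb
  have haC : a ∈ M.fundCircuit b B := by
    rw [hB.indep.mem_fundCircuit_iff (hB.closure_eq.symm ▸ hbE) hb,
      ← Set.insert_sdiff_singleton_comm hab]
    exact hBb.indep
  have hbC := M.mem_fundCircuit b B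
  have hstep : ∀ x ∈ M.fundCircuit b B, ∀ y ∈ M.fundCircuit b B, x ∈ S → y ∈ S := by
    rintro x hx y hy (rfl | ⟨C, hC', heC, hxC⟩)
    · exact Or.inr ⟨_, hC, hx, hy⟩
    · exact Or.inr (exists_isCircuit_mem_trans hC' hC heC hy ⟨x, hxC, hx⟩)
  have hBfin := M.ground_finite.subset hB.subset_ground
  by_cases haS : a ∈ S
  · have hbS := hstep a haC b hbC haS
    have h1 : insert b (B \ {a}) ∩ S = insert b ((B ∩ S) \ {a}) := by
      ext x
      simp only [Set.mem_inter_iff, Set.mem_insert_iff, Set.mem_sdiff, Set.mem_singleton_iff]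
      constructor
      · rintro ⟨rfl | hx, hxS⟩
        · exact Or.inl rfl
        · exact Or.inr ⟨⟨hx.1, hxS⟩, hx.2⟩
      · rintro (rfl | hx)
        · exact ⟨Or.inl rfl, hbS⟩
        · exact ⟨Or.inr ⟨hx.1.1, hx.2⟩, hx.1.2⟩
    change (B ∩ S).ncard = (insert b (B \ {a}) ∩ S).ncard
    rw [h1]
    exact (Set.ncard_exchange (s := B ∩ S) (fun h => hb h.1) ⟨ha, haS⟩).symm
  · have hbS : b ∉ S := fun h => haS (hstep b hbC a haC h)
    change (B ∩ S).ncard = (insert b (B \ {a}) ∩ S).ncard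
    congr 1
    ext x
    simp only [Set.mem_inter_iff, Set.mem_insert_iff, Set.mem_sdiff, Set.mem_singleton_iff]
    constructor
    · rintro ⟨hx, hxS⟩
      exact ⟨Or.inr ⟨hx, fun h => haS (h ▸ hxS)⟩, hxS⟩
    · rintro ⟨rfl | hx, hxS⟩
      · exact absurd hxS hbS
      · exact ⟨hx.1, hxS⟩

end MatroidLemmas

/-! ### Minimizers of functions perturbed by linear forms -/

section ArgMin

open Classical in
/-- The set of the minimizers of `h` on `s`. -/
def argMin {β : Type*} (s : Finset β) (h : β → ℝ) : Finset β :=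
  s.filter fun b => ∀ b' ∈ s, h b ≤ h b'

variable {β : Type*} {s : Finset β} {h u : β → ℝ} {b : β}

theorem mem_argMin : b ∈ argMin s h ↔ b ∈ s ∧ ∀ b' ∈ s, h b ≤ h b' := by
  simp [argMin]

theorem argMin_subset : argMin s h ⊆ s := fun _ hb => (mem_argMin.1 hb).1

theorem argMin_nonempty (hs : s.Nonempty) (h : β → ℝ) : (argMin s h).Nonempty := by
  obtain ⟨b, hb, hmin⟩ := Finset.exists_min_image s h hs
  exact ⟨b, mem_argMin.2 ⟨hb, hmin⟩⟩

theorem argMin_smul {t : ℝ} (ht : 0 < t) : argMin s (fun b => t * h b) = argMin s h := by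
  ext b
  simp only [mem_argMin, mul_le_mul_iff_right₀ ht]

/-- For small ε the finitely many strict inequalities between values of h survive, so only ties are
broken. -/
theorem argMin_perturb (s : Finset β) (h u : β → ℝ) :
    ∃ ε > 0, argMin s (fun b => h b - ε * u b) = argMin (argMin s h) (fun b => -u b) := by
  have hev : ∀ᶠ ε : ℝ in nhdsWithin 0 (Set.Ioi 0), ∀ b ∈ s, ∀ b' ∈ s, h b < h b' →
      h b - ε * u b < h b' - ε * u b' := by
    rw [Filter.eventually_all_finset]
    intro b _
    rw [Filter.eventually_all_finset]
    intro b' _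
    by_cases hlt : h b < h b'
    · refine Filter.Eventually.filter_mono nhdsWithin_le_nhds ?_
      have hc : ContinuousAt (fun ε : ℝ => (h b' - ε * u b') - (h b - ε * u b)) 0 := by fun_prop
      filter_upwards [hc.eventually (lt_mem_nhds (a := 0) (by simpa using hlt))] with ε hε _
      linarith
    · exact Filter.Eventually.of_forall fun _ h => absurd h hlt
  obtain ⟨ε, hε, hpos⟩ := (hev.and self_mem_nhdsWithin).exists
  refine ⟨ε, hpos, ?_⟩
  have hpos : 0 < ε := hpos
  ext b
  simp only [mem_argMin]
  constructor
  · rintro ⟨hb, hmin⟩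
    have hb' : ∀ b' ∈ s, h b ≤ h b' := fun b' hb' => by
      by_contra hlt
      exact absurd (hmin b' hb') (not_le.2 (hε b' hb' b hb (not_le.1 hlt)))
    refine ⟨⟨hb, hb'⟩, fun b' ⟨hbs, hbm⟩ => ?_⟩
    have h1 := hmin b' hbs
    have h2 := hbm b hb
    nlinarith
  · rintro ⟨⟨hb, hmin⟩, hu⟩
    refine ⟨hb, fun b' hb' => ?_⟩
    rcases (hmin b' hb').lt_or_eq with hlt | heq
    · exact (hε b hb b' hb' hlt).le
    · have := hu b' ⟨hb', fun c hc => heq ▸ hmin c hc⟩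
      nlinarith

/-- This is the small perturbation of -g by h, rescaled by t = ε⁻¹. -/
theorem argMin_perturb_large (s : Finset β) (h g : β → ℝ) :
    ∃ t > 0, argMin s (fun b => h b - t * g b) = argMin (argMin s (fun b => -g b)) h := by
  obtain ⟨ε, hε, he⟩ := argMin_perturb s (fun b => -g b) (fun b => -h b)
  refine ⟨ε⁻¹, inv_pos.2 hε, ?_⟩
  simp only [neg_neg] at he
  rw [← he, ← argMin_smul (s := s) (h := fun b => -g b - ε * -h b) (inv_pos.2 hε)]
  congr 1
  ext b
  field_simp
  ring

/-- Tilting along u keeps the old minimizers tied. The least ratio (h b - min h) / (u b - a) over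
the b with u b > a is the moment when a new minimizer joins them. -/
theorem exists_argMin_ssubset {a : ℝ} (hs : s.Nonempty) (hu : ∀ b ∈ argMin s h, u b = a)
    (hb : ∃ b ∈ s, a < u b) : ∃ t : ℝ, argMin s h ⊂ argMin s (fun b => h b - t * u b) := by
  classical
  obtain ⟨b₀, hb₀⟩ := argMin_nonempty hs h
  obtain ⟨hb₀s, hmin⟩ := mem_argMin.1 hb₀
  have hpne : (s.filter fun b => a < u b).Nonempty := by
    obtain ⟨b, hb, hab⟩ := hb
    exact ⟨b, Finset.mem_filter.2 ⟨hb, hab⟩⟩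
  obtain ⟨b₁, hb₁, hb₁min⟩ := Finset.exists_min_image _
    (fun b => (h b - h b₀) / (u b - a)) hpne
  obtain ⟨hb₁s, hab₁⟩ := Finset.mem_filter.1 hb₁
  set t := (h b₁ - h b₀) / (u b₁ - a) with ht
  have ht0 : 0 ≤ t := div_nonneg (by linarith [hmin b₁ hb₁s]) (by linarith)
  have ht1 : t * (u b₁ - a) = h b₁ - h b₀ := div_mul_cancel₀ _ (by linarith)
  have key : ∀ b ∈ s, h b₀ - t * a ≤ h b - t * u b := fun b hbs => by
    by_cases hab : a < u b
    · have := hb₁min b (Finset.mem_filter.2 ⟨hbs, hab⟩)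
      rw [le_div_iff₀ (by linarith)] at this
      linarith
    · nlinarith [hmin b hbs]
  refine ⟨t, fun b hb => ?_, fun hsub => ?_⟩
  · obtain ⟨hbs, hbm⟩ := mem_argMin.1 hb
    refine mem_argMin.2 ⟨hbs, fun b' hb' => ?_⟩
    have := key b' hb'
    have := hbm b₀ hb₀s
    rw [hu b hb]
    linarith
  · have : b₁ ∈ argMin s h := hsub (mem_argMin.2 ⟨hb₁s, fun b' hb' => by
      have := key b' hb'
      linarith⟩)
    linarith [hu b₁ this]

variable {α : Type*}

/-- The minimizers of `ω B - ∑ i ∈ B, x i` for `B ∈ 𝓑`. -/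
def initialSets (𝓑 : Finset (Finset α)) (ω : Finset α → ℝ) (x : α → ℝ) : Finset (Finset α) :=
  argMin 𝓑 fun B => ω B - ∑ i ∈ B, x i

variable {𝓑 : Finset (Finset α)} {ω : Finset α → ℝ} {x : α → ℝ} {B : Finset α}

theorem mem_initialSets : B ∈ initialSets 𝓑 ω x ↔
    B ∈ 𝓑 ∧ ∀ B' ∈ 𝓑, ω B - ∑ i ∈ B, x i ≤ ω B' - ∑ i ∈ B', x i := mem_argMin

theorem sub_sum_add_mul (ω : Finset α → ℝ) (x g : α → ℝ) (t : ℝ) (B : Finset α) :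
    ω B - ∑ i ∈ B, (x i + t * g i) = (ω B - ∑ i ∈ B, x i) - t * ∑ i ∈ B, g i := by
  rw [Finset.sum_add_distrib, Finset.mul_sum]
  ring

theorem initialSets_perturb (𝓑 : Finset (Finset α)) (ω : Finset α → ℝ) (x g : α → ℝ) :
    ∃ ε > 0, initialSets 𝓑 ω (fun i => x i + ε * g i) =
      argMin (initialSets 𝓑 ω x) (fun B => -∑ i ∈ B, g i) := by
  simp only [initialSets, sub_sum_add_mul]
  exact argMin_perturb _ _ _

theorem initialSets_perturb_large (𝓑 : Finset (Finset α)) (ω : Finset α → ℝ) (x g : α → ℝ) :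
    ∃ t > 0, initialSets 𝓑 ω (fun i => x i + t * g i) =
      initialSets (argMin 𝓑 (fun B => -∑ i ∈ B, g i)) ω x := by
  simp only [initialSets, sub_sum_add_mul]
  exact argMin_perturb_large _ _ _

/-- Since B minimizes both functions, the minimizers of any positive combination are exactly the
common minimizers. Hence this holds along the whole ray, not only for small or large t. -/
theorem initialSets_add_of_mem_argMin (g : α → ℝ) {t : ℝ} (ht : 0 < t)
    (hB : B ∈ initialSets 𝓑 ω x) (hBg : B ∈ argMin 𝓑 (fun B => -∑ i ∈ B, g i)) :
    initialSets 𝓑 ω (fun i => x i + t * g i) =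
      argMin (initialSets 𝓑 ω x) (fun B => -∑ i ∈ B, g i) := by
  obtain ⟨hB𝓑, hBm⟩ := mem_initialSets.1 hB
  obtain ⟨-, hBg⟩ := mem_argMin.1 hBg
  ext B'
  rw [mem_argMin]
  simp only [mem_initialSets, sub_sum_add_mul]
  constructor
  · rintro ⟨h1, h2⟩
    have h3 := h2 B hB𝓑
    have h4 := hBm B' h1
    have h5 := hBg B' h1
    have h6 : t * ∑ i ∈ B', g i ≤ t * ∑ i ∈ B, g i := by nlinarith
    refine ⟨⟨h1, fun B'' hB'' => by linarith [hBm B'' hB'']⟩, fun B'' hB'' => ?_⟩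
    have h7 := hBg B'' hB''.1
    have h8 : t * ∑ i ∈ B, g i ≤ t * ∑ i ∈ B', g i := by linarith
    have := le_of_mul_le_mul_left h8 ht
    linarith
  · rintro ⟨⟨h1, h2⟩, h3⟩
    refine ⟨h1, fun B'' hB'' => ?_⟩
    have h4 := h3 B ⟨hB𝓑, hBm⟩
    have h5 := hBg B'' hB''
    have h6 := h2 B'' hB''
    have : t * ∑ i ∈ B'', g i ≤ t * ∑ i ∈ B', g i :=
      mul_le_mul_of_nonneg_left (by linarith) ht.le
    linarith

/-- Every set of minimizers is contained in one on which only those linear forms are constant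
that are constant on all of `𝓑`. -/
theorem exists_initialSets_superset [Fintype α] (h𝓑 : 𝓑.Nonempty) (x : α → ℝ) :
    ∃ v, initialSets 𝓑 ω x ⊆ initialSets 𝓑 ω v ∧
      ∀ (u : α → ℝ) (a : ℝ), (∀ B ∈ initialSets 𝓑 ω v, ∑ i ∈ B, u i = a) →
        ∀ B ∈ 𝓑, ∑ i ∈ B, u i = a := by
  classical
  induction hN : (𝓑 \ initialSets 𝓑 ω x).card using Nat.strong_induction_on generalizing x with
  | _ N ih =>
  subst hN
  by_cases hx : ∀ (u : α → ℝ) (a : ℝ), (∀ B ∈ initialSets 𝓑 ω x, ∑ i ∈ B, u i = a) →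
        ∀ B ∈ 𝓑, ∑ i ∈ B, u i = a
  · exact ⟨x, subset_rfl, hx⟩
  push Not at hx
  obtain ⟨u, a, hu, B, hB, hBa⟩ := hx
  -- The tilt is along u or -u, whichever exceeds its constant value at B.
  have hstep : ∃ y, initialSets 𝓑 ω x ⊂ initialSets 𝓑 ω y := by
    rcases lt_or_gt_of_ne hBa with hlt | hgt
    · obtain ⟨t, ht⟩ := exists_argMin_ssubset (h := fun B => ω B - ∑ i ∈ B, x i)
        (u := fun B => -∑ i ∈ B, u i) (a := -a) h𝓑
        (fun B hB => by rw [hu B hB]) ⟨B, hB, neg_lt_neg hlt⟩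
      refine ⟨fun i => x i + (-t) * u i, ?_⟩
      have e : initialSets 𝓑 ω (fun i => x i + (-t) * u i) =
          argMin 𝓑 (fun B => (ω B - ∑ i ∈ B, x i) - t * (-∑ i ∈ B, u i)) := by
        simp only [initialSets]
        congr 1
        ext B
        rw [sub_sum_add_mul]
        ring
      rw [e]
      exact ht
    · obtain ⟨t, ht⟩ := exists_argMin_ssubset (h := fun B => ω B - ∑ i ∈ B, x i)
        (u := fun B => ∑ i ∈ B, u i) (a := a) h𝓑 hu ⟨B, hB, hgt⟩
      refine ⟨fun i => x i + t * u i, ?_⟩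
      have e : initialSets 𝓑 ω (fun i => x i + t * u i) =
          argMin 𝓑 (fun B => (ω B - ∑ i ∈ B, x i) - t * ∑ i ∈ B, u i) := by
        simp only [initialSets, sub_sum_add_mul]
      rw [e]
      exact ht
  obtain ⟨y, hy⟩ := hstep
  have hlt : (𝓑 \ initialSets 𝓑 ω y).card < (𝓑 \ initialSets 𝓑 ω x).card := by
    refine Finset.card_lt_card ⟨Finset.sdiff_subset_sdiff subset_rfl hy.1, fun h => hy.2 ?_⟩
    intro B hB
    by_contra hBx
    exact (Finset.mem_sdiff.1 (h (Finset.mem_sdiff.2 ⟨argMin_subset hB, hBx⟩))).2 hB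
  obtain ⟨v, hv, hv'⟩ := ih _ hlt y rfl
  exact ⟨v, hy.1.trans hv, hv'⟩

end ArgMin

/-! ### Optimal assignments -/

section Assignment

variable {ι κ : Type*} [Fintype ι] [DecidableEq ι]

/-- If every column used by an optimal assignment `σ` is avoided by another optimal assignment,
then `σ` uses only minimal entries of the rows. -/
theorem le_of_optimal_assignment {E : ι → κ → Prop} {c : ι → κ → ℝ} {σ τ : ι → κ}
    (hσ : Function.Injective σ) (hσE : ∀ i, E i (σ i))
    (hσo : ∀ ρ : ι → κ, Function.Injective ρ → (∀ i, E i (ρ i)) →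
      ∑ i, c i (σ i) ≤ ∑ i, c i (ρ i))
    (hτ : Function.Injective τ) (hτE : ∀ i, E i (τ i))
    (hτo : ∀ ρ : ι → κ, Function.Injective ρ → (∀ i, E i (ρ i)) →
      ∑ i, c i (τ i) ≤ ∑ i, c i (ρ i))
    {i : ι} {j : κ} (hij : E i j) (hjτ : ∀ k, τ k ≠ j) : c i (σ i) ≤ c i j := by
  classical
  by_cases hj : ∃ k, σ k = j
  swap
  · push Not at hj
    have := hσo (Function.update σ i j) (fun a b hab => ?_) (fun a => ?_)
    · rw [← Finset.add_sum_erase _ _ (Finset.mem_univ i),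
        ← Finset.add_sum_erase _ (fun a => c a (Function.update σ i j a)) (Finset.mem_univ i),
        Finset.sum_congr (rfl : Finset.univ.erase i = Finset.univ.erase i)
          (g := fun a => c a (σ a)) (f := fun a => c a (Function.update σ i j a))
          (fun a ha => by rw [Function.update_of_ne (Finset.ne_of_mem_erase ha)])] at this
      rw [Function.update_self] at this
      linarith
    · by_cases ha : a = i <;> by_cases hb : b = i
      · rw [ha, hb]
      · subst ha
        rw [Function.update_self, Function.update_of_ne hb] at hab
        exact absurd hab.symm (hj b)
      · subst hb
        rw [Function.update_self, Function.update_of_ne ha] at hab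
        exact absurd hab (hj a)
      · rw [Function.update_of_ne ha, Function.update_of_ne hb] at hab
        exact hσ hab
    · by_cases ha : a = i
      · subst ha; rwa [Function.update_self]
      · rw [Function.update_of_ne ha]; exact hσE a
  obtain ⟨i₀, hi₀⟩ := hj
  by_cases hii : i₀ = i
  · rw [← hii, hi₀]
  -- `r k m`: moving row k to its τ-column displaces row m. Since τ avoids j, nothing displaces i₀,
  -- so the displacements from i₀ form a path; Q is the part of it before i.
  set r : ι → ι → Prop := fun k m => τ k = σ m with hr
  set Q : ι → Prop := fun k => Relation.ReflTransGen r i₀ k ∧ ¬ Relation.ReflTransGen r i k with hQ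
  have hpred : ∀ k, ¬ r k i₀ := fun k hk => hjτ k (hk.trans hi₀)
  have hQ₀ : Q i₀ := ⟨.refl, fun h => by
    rcases Relation.ReflTransGen.cases_tail h with h | ⟨k, -, hk⟩
    · exact hii h
    · exact hpred k hk⟩
  have hQi : ¬ Q i := fun h => h.2 .refl
  have hback : ∀ k m, r k m → Q m → Q k := by
    rintro k m hkm ⟨h1, h2⟩
    refine ⟨?_, fun h => h2 (h.tail hkm)⟩
    rcases Relation.ReflTransGen.cases_tail h1 with h | ⟨k', h, hk'⟩
    · exact absurd (h ▸ hkm) (hpred k)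
    · have : k = k' := hτ (hkm.trans hk'.symm)
      exact this ▸ h
  have hforw : ∀ k m, r k m → Q k → m = i ∨ Q m := by
    rintro k m hkm ⟨h1, h2⟩
    by_cases hmi : m = i
    · exact Or.inl hmi
    refine Or.inr ⟨h1.tail hkm, fun h => ?_⟩
    rcases Relation.ReflTransGen.cases_tail h with h | ⟨k', h, hk'⟩
    · exact hmi h
    · have : k = k' := hτ (hkm.trans hk'.symm)
      exact h2 (this ▸ h)
  have hsplit : ∀ f : ι → ℝ, ∑ k, f k = ∑ k with Q k, f k + ∑ k with ¬ Q k, f k :=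
    fun f => (Finset.sum_filter_add_sum_filter_not _ _ _).symm
  -- Replacing τ by σ on Q is again injective, and τ is optimal.
  have h1 : ∑ k with Q k, c k (τ k) ≤ ∑ k with Q k, c k (σ k) := by
    have := hτo (fun k => if Q k then σ k else τ k) (fun a b hab => ?_) (fun a => ?_)
    · rw [hsplit, hsplit (fun k => c k (if Q k then σ k else τ k)),
        Finset.sum_congr (rfl : Finset.univ.filter Q = _)
          (f := fun k => c k (if Q k then σ k else τ k)) (g := fun k => c k (σ k))
          (fun k hk => by rw [if_pos (Finset.mem_filter.1 hk).2]),
        Finset.sum_congr (rfl : Finset.univ.filter (fun k => ¬ Q k) = _)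
          (f := fun k => c k (if Q k then σ k else τ k)) (g := fun k => c k (τ k))
          (fun k hk => by rw [if_neg (Finset.mem_filter.1 hk).2])] at this
      linarith
    · simp only at hab
      split_ifs at hab with ha hb hb
      · exact hσ hab
      · exact absurd (hback b a hab.symm ha) hb
      · exact absurd (hback a b hab hb) ha
      · exact hτ hab
    · split_ifs
      · exact hσE a
      · exact hτE a
  -- Row i takes j, the rows of Q move on to τ, and the others keep σ. If the path reaches i, its
  -- column has just been vacated.
  have h2 := hσo (fun k => if k = i then j else if Q k then τ k else σ k) (fun a b hab => ?_)
    (fun a => ?_)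
  · have hmem : i ∈ Finset.univ.filter (fun k => ¬ Q k) := by simp [hQi]
    rw [hsplit, hsplit (fun k => c k (if k = i then j else if Q k then τ k else σ k)),
      Finset.sum_congr (rfl : Finset.univ.filter Q = _)
        (f := fun k => c k (if k = i then j else if Q k then τ k else σ k))
        (g := fun k => c k (τ k))
        (fun k hk => by
          have hk := (Finset.mem_filter.1 hk).2
          have hki : k ≠ i := fun h => hQi (h ▸ hk)
          rw [if_neg hki, if_pos hk]),
      ← Finset.add_sum_erase _ _ hmem,
      ← Finset.add_sum_erase _ (fun k => c k (if k = i then j else if Q k then τ k else σ k)) hmem,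
      Finset.sum_congr (rfl : (Finset.univ.filter (fun k => ¬ Q k)).erase i = _)
        (f := fun k => c k (if k = i then j else if Q k then τ k else σ k))
        (g := fun k => c k (σ k))
        (fun k hk => by
          obtain ⟨hk1, hk2⟩ := Finset.mem_erase.1 hk
          rw [if_neg hk1, if_neg (Finset.mem_filter.1 hk2).2]), if_pos rfl] at h2
    linarith
  · have hσj : ∀ k, ¬ Q k → σ k ≠ j := fun k hk h => hk ((hσ (h.trans hi₀.symm)) ▸ hQ₀)
    beta_reduce at hab
    split_ifs at hab with ha hb hb hb hb ha' hb' hb'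
    all_goals first
      | exact ha.trans hb.symm
      | exact absurd hab.symm (hjτ _)
      | exact absurd hab (hjτ _)
      | exact absurd hab.symm (hσj _ ‹_›)
      | exact absurd hab (hσj _ ‹_›)
      | exact hτ hab
      | exact hσ hab
      | skip
    · rcases hforw a b hab ‹_› with h | h <;> contradiction
    · rcases hforw b a hab.symm ‹_› with h | h <;> contradiction
  · split_ifs with h
    · exact h ▸ hij
    · exact hτE a
    · exact hσE a

end Assignment

theorem matroidCorank_eq_encard {α : Type*} {M : Matroid α} [M.Finite] {B F : Set α}
    (hB : M.IsBase B) (hBF : M.IsBasis (B ∩ F) F) : matroidCorank M F = (B \ F).encard := by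
  rw [matroidCorank, ← hB.encard_eq_eRank, ← hBF.encard_eq_eRk,
    ← Set.encard_sdiff_add_encard_inter B F]
  have hfin : (B ∩ F).encard ≠ ⊤ :=
    Set.encard_ne_top_iff.2 ((M.ground_finite.subset hB.subset_ground).subset Set.inter_subset_left)
  exact (ENat.addLECancellable_of_ne_top hfin).add_tsub_cancel_right

theorem countIn_eq_countP {n d : ℕ} (A : Fin d → TropProj n) (R : Set (TropProj n))
    [DecidablePred (· ∈ R)] :
    countIn A R = ((Finset.univ.val.map A).countP (· ∈ R) : ℕ) := by
  rw [countIn, Multiset.countP_map]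
  have : {i | A i ∈ R} = ((Finset.univ.filter fun i => A i ∈ R : Finset (Fin d)) : Set (Fin d)) := by
    ext i; simp
  rw [this, Set.encard_coe_eq_coe_finsetCard]
  rfl

/-! ### Initial matroids in terms of real heights -/

namespace ValuatedMatroid

variable {n d : ℕ} (V : ValuatedMatroid n d)

open Classical in
/-- The bases of the underlying matroid, as finite sets. -/
def baseSets : Finset (Finset (Fin n)) := Finset.univ.filter fun B => V.val B ≠ ⊤

/-- The value of a base, as a real number. -/
def valReal (B : Finset (Fin n)) : ℝ := (V.val B).untopD 0

variable {V} {B : Finset (Fin n)} {x : Fin n → ℝ}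

theorem mem_baseSets : B ∈ V.baseSets ↔ V.val B ≠ ⊤ := by simp [baseSets]

theorem coe_valReal (h : V.val B ≠ ⊤) : (V.valReal B : WithTop ℝ) = V.val B := by
  obtain ⟨r, hr⟩ := WithTop.ne_top_iff_exists.1 h
  rw [valReal, ← hr]
  simp

theorem baseSets_nonempty : V.baseSets.Nonempty := by
  obtain ⟨B, hB⟩ := V.exists_ne_top
  exact ⟨B, mem_baseSets.2 hB⟩

theorem card_of_mem_baseSets (h : B ∈ V.baseSets) : B.card = d :=
  V.card_of_ne_top (mem_baseSets.1 h)

theorem underlying_isBase_coe : V.underlying.IsBase (B : Set (Fin n)) ↔ B ∈ V.baseSets := by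
  rw [mem_baseSets]
  change (∃ B' : Finset (Fin n), (B' : Set (Fin n)) = B ∧ V.val B' ≠ ⊤) ↔ _
  simp

theorem height_eq (h : V.val B ≠ ⊤) :
    V.height x B = ((V.valReal B - ∑ i ∈ B, x i : ℝ) : WithTop ℝ) := by
  rw [height, ← coe_valReal h, sub_eq_add_neg, WithTop.coe_add]

theorem initial_isBase_coe : (V.initial x).IsBase (B : Set (Fin n)) ↔
    B ∈ initialSets V.baseSets V.valReal x := by
  rw [mem_initialSets, mem_baseSets]
  change (∃ B' : Finset (Fin n), (B' : Set (Fin n)) = B ∧ V.val B' ≠ ⊤ ∧ _) ↔ _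
  simp only [Finset.coe_inj, exists_eq_left]
  refine and_congr_right fun hB => forall_congr' fun B' => ?_
  rw [mem_baseSets]
  by_cases hB' : V.val B' = ⊤
  · simp [hB', height]
  · rw [height_eq hB, height_eq hB', WithTop.coe_le_coe]
    simp [hB']

instance : (V.initial x).Finite := ⟨Set.finite_univ⟩

instance : V.underlying.Finite := ⟨Set.finite_univ⟩

theorem ext_isBase_coe {M N : Matroid (Fin n)} (hM : M.E = Set.univ) (hN : N.E = Set.univ)
    (h : ∀ B : Finset (Fin n), M.IsBase (B : Set (Fin n)) ↔ N.IsBase (B : Set (Fin n))) :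
    M = N := by
  refine ext_isBase (hM.trans hN.symm) fun S _ => ?_
  obtain ⟨B, rfl⟩ := S.toFinite.exists_finset_coe
  exact h B

theorem isBase_of_initial {S : Set (Fin n)} (h : (V.initial x).IsBase S) :
    ∃ B : Finset (Fin n), (B : Set (Fin n)) = S ∧ B ∈ initialSets V.baseSets V.valReal x := by
  obtain ⟨B, rfl⟩ := S.toFinite.exists_finset_coe
  exact ⟨B, rfl, initial_isBase_coe.1 h⟩

end ValuatedMatroid

/-! ### Tropical vectors -/

namespace TropVec

variable {n d : ℕ}

/-- The entries of a tropical vector as real numbers, with value `0` in place of `∞`. -/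
def toReal (y : TropVec n) (j : Fin n) : ℝ := (y.1 j).untopD 0

theorem coe_toReal {y : TropVec n} {j : Fin n} (h : y.1 j ≠ ⊤) :
    (toReal y j : WithTop ℝ) = y.1 j := by
  obtain ⟨r, hr⟩ := WithTop.ne_top_iff_exists.1 h
  rw [toReal, ← hr]
  simp

theorem add_coe_eq {y : TropVec n} {j : Fin n} (h : y.1 j ≠ ⊤) (r : ℝ) :
    y.1 j + ((-r : ℝ) : WithTop ℝ) = ((toReal y j - r : ℝ) : WithTop ℝ) := by
  rw [← coe_toReal h, sub_eq_add_neg, WithTop.coe_add]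

theorem notMem_relSupp {x : Fin n → ℝ} {y : TropVec n} {j : Fin n} :
    j ∉ relSupp x (Quotient.mk _ y) ↔
      y.1 j ≠ ⊤ ∧ ∀ k, y.1 k ≠ ⊤ → toReal y j - x j ≤ toReal y k - x k := by
  change ¬ (∃ k, y.1 k + ((-x k : ℝ) : WithTop ℝ) < y.1 j + ((-x j : ℝ) : WithTop ℝ)) ↔ _
  push Not
  constructor
  · intro h
    have hj : y.1 j ≠ ⊤ := fun hj => by
      obtain ⟨k, hk⟩ := y.2
      have := h k
      rw [hj, top_add, add_coe_eq hk] at this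
      exact absurd this (by simp)
    refine ⟨hj, fun k hk => ?_⟩
    have := h k
    rwa [add_coe_eq hj, add_coe_eq hk, WithTop.coe_le_coe] at this
  · rintro ⟨hj, h⟩ k
    by_cases hk : y.1 k = ⊤
    · rw [hk, top_add]; exact le_top
    · rw [add_coe_eq hj, add_coe_eq hk, WithTop.coe_le_coe]
      exact h k hk

variable {a : Fin d → TropVec n} {ρ : Fin d → Fin n} {B : Finset (Fin n)}

theorem sum_eq_coe (h : ∀ i, (a i).1 (ρ i) ≠ ⊤) :
    ∑ i, (a i).1 (ρ i) = ((∑ i, toReal (a i) (ρ i) : ℝ) : WithTop ℝ) := by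
  rw [WithTop.coe_sum]
  exact Finset.sum_congr rfl fun i _ => (coe_toReal (h i)).symm

theorem tropicalMinor_le (h : ∀ i, (a i).1 (ρ i) ≠ ⊤) (hB : Finset.univ.image ρ = B) :
    tropicalMinor (fun i => (a i).1) B ≤ ((∑ i, toReal (a i) (ρ i) : ℝ) : WithTop ℝ) := by
  rw [← sum_eq_coe h]
  exact Finset.inf_le (f := fun j : Fin d → Fin n => ∑ i, (a i).1 (j i)) (by simpa using hB)

theorem exists_eq_tropicalMinor (hB : tropicalMinor (fun i => (a i).1) B ≠ ⊤) :
    ∃ ρ : Fin d → Fin n, (∀ i, (a i).1 (ρ i) ≠ ⊤) ∧ Finset.univ.image ρ = B ∧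
      tropicalMinor (fun i => (a i).1) B = ((∑ i, toReal (a i) (ρ i) : ℝ) : WithTop ℝ) := by
  rw [tropicalMinor] at hB ⊢
  have hne : (Finset.univ.filter fun j : Fin d → Fin n => Finset.univ.image j = B).Nonempty := by
    rw [Finset.nonempty_iff_ne_empty]
    intro h
    rw [h] at hB
    exact hB rfl
  obtain ⟨ρ, hρ, he⟩ := Finset.exists_mem_eq_inf _ hne
    (fun j : Fin d → Fin n => ∑ i, (a i).1 (j i))
  rw [he] at hB ⊢
  have hfin : ∀ i, (a i).1 (ρ i) ≠ ⊤ := fun i => WithTop.sum_ne_top.1 hB i (Finset.mem_univ i)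
  exact ⟨ρ, hfin, (Finset.mem_filter.1 hρ).2, sum_eq_coe hfin⟩

theorem injective_of_image_eq (hB : Finset.univ.image ρ = B) (hc : B.card = d) :
    Function.Injective ρ := by
  rw [← Set.injOn_univ, ← Finset.coe_univ, ← Finset.card_image_iff, hB, hc, Finset.card_fin]

theorem sum_image_eq (hρ : Function.Injective ρ) (hB : Finset.univ.image ρ = B) (x : Fin n → ℝ) :
    ∑ i, x (ρ i) = ∑ j ∈ B, x j := by
  rw [← hB, Finset.sum_image (fun i _ j _ h => hρ h)]

end TropVec

/-! ### Relative supports and optimal matchings -/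

namespace ValuatedMatroid

variable {n d : ℕ} {V : ValuatedMatroid n d}

open TropVec

/-- For e outside F and a base B avoiding e, the double minimum on B ∪ {e} offers a j ≠ e whose
exchange costs no more. Minimality of e and of B forces equality, so B' is again initial and j ∉ F,
whence B' ∩ F = B ∩ F. -/
theorem isFlat_relSupp {p : TropProj n} (hp : p ∈ V.linearSpace) (x : Fin n → ℝ) :
    (V.initial x).IsFlat (relSupp x p) := by
  obtain ⟨y, rfl⟩ := Quotient.exists_rep p
  set F := relSupp x (Quotient.mk _ y) with hF
  have hFE : F ⊆ (V.initial x).E := Set.subset_univ _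
  rw [isFlat_iff_exists_isBase hFE]
  rintro e ⟨-, he⟩
  obtain ⟨S, hS, hSF⟩ := exists_isBase_inter_isBasis hFE
  by_cases heS : e ∈ S
  · exact ⟨S, hS, hSF, heS⟩
  obtain ⟨B, rfl, hB⟩ := isBase_of_initial hS
  have heB : e ∉ B := heS
  obtain ⟨hB1, hB2⟩ := mem_initialSets.1 hB
  have hBt := mem_baseSets.1 hB1
  obtain ⟨het, hemin⟩ := notMem_relSupp.1 he
  obtain ⟨j, hj, hje, hjle⟩ : ∃ j ∈ insert e B, j ≠ e ∧
      y.1 j + V.val ((insert e B).erase j) ≤ y.1 e + V.val ((insert e B).erase e) := by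
    obtain ⟨j₁, hj₁, j₂, hj₂, hne, hmin⟩ := hp y rfl (insert e B) (by
      rw [Finset.card_insert_of_notMem heB, card_of_mem_baseSets hB1])
    by_cases h : j₁ = e
    · exact ⟨j₂, hj₂, fun h' => hne (h.trans h'.symm), (hmin e (by simp)).2⟩
    · exact ⟨j₁, hj₁, h, (hmin e (by simp)).1⟩
  have hjB : j ∈ B := (Finset.mem_insert.1 hj).resolve_left hje
  rw [Finset.erase_insert heB, ← coe_toReal het, ← coe_valReal hBt, ← WithTop.coe_add] at hjle
  obtain ⟨hjt, hB't⟩ := WithTop.add_ne_top.1 (ne_top_of_le_ne_top WithTop.coe_ne_top hjle)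
  rw [← coe_toReal hjt, ← coe_valReal hB't, ← WithTop.coe_add, WithTop.coe_le_coe] at hjle
  set B' := (insert e B).erase j with hB'
  have hsum : ∑ i ∈ B', x i + x j = ∑ i ∈ B, x i + x e := by
    rw [hB', Finset.sum_erase_add _ _ hj, Finset.sum_insert heB, add_comm]
  have h1 := hemin j hjt
  have h2 := hB2 B' (mem_baseSets.2 hB't)
  have hB'mem : B' ∈ initialSets V.baseSets V.valReal x :=
    mem_initialSets.2 ⟨mem_baseSets.2 hB't, fun C hC => by linarith [hB2 C hC]⟩
  have hjF : j ∉ F := notMem_relSupp.2 ⟨hjt, fun k hk => by linarith [hemin k hk]⟩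
  refine ⟨B', initial_isBase_coe.2 hB'mem, ?_, ?_⟩
  · have : (B' : Set (Fin n)) ∩ F = (B : Set (Fin n)) ∩ F := by
      ext k
      simp only [hB', Set.mem_inter_iff, Finset.mem_coe, Finset.mem_erase, Finset.mem_insert]
      constructor
      · rintro ⟨⟨-, rfl | h⟩, hk⟩
        · exact absurd hk he
        · exact ⟨h, hk⟩
      · rintro ⟨h, hk⟩
        exact ⟨⟨fun h => hjF (h ▸ hk), Or.inr h⟩, hk⟩
    rwa [this]
  · simp [hB', hje.symm]

/-- In a presentation, the optimal assignments at a point whose initial matroid has no coloops use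
only minimal entries of the rows. -/
theorem notMem_relSupp_of_presentation {a : Fin d → TropVec n} {c : ℝ}
    (ha : ∀ B : Finset (Fin n), B.card = d →
      tropicalMinor (fun i => (a i).1) B = V.val B + (c : WithTop ℝ))
    {z : Fin n → ℝ} {σ : Fin d → Fin n} {B : Finset (Fin n)}
    (hB : B ∈ initialSets V.baseSets V.valReal z)
    (hσE : ∀ i, (a i).1 (σ i) ≠ ⊤) (hσB : Finset.univ.image σ = B)
    (hσ : ∑ i, toReal (a i) (σ i) = V.valReal B + c)
    (hz : ∀ e, (∀ j, j = e) ∨ ∃ B' ∈ initialSets V.baseSets V.valReal z, e ∉ B') (i : Fin d) :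
    σ i ∉ relSupp z (Quotient.mk _ (a i)) := by
  -- An injective assignment costs at least the minor of its image, and the minors are V + c; so
  -- minimality of B at z makes σ optimal over all choices of columns.
  have hopt : ∀ (B : Finset (Fin n)), B ∈ initialSets V.baseSets V.valReal z →
      ∀ σ : Fin d → Fin n, Finset.univ.image σ = B →
      ∑ i, toReal (a i) (σ i) = V.valReal B + c → Function.Injective σ ∧
      ∀ ρ : Fin d → Fin n, Function.Injective ρ → (∀ i, (a i).1 (ρ i) ≠ ⊤) →
        ∑ i, (toReal (a i) (σ i) - z (σ i)) ≤ ∑ i, (toReal (a i) (ρ i) - z (ρ i)) := by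
    intro B hB σ hσB hσ
    obtain ⟨hB1, hB2⟩ := mem_initialSets.1 hB
    have hσi := injective_of_image_eq hσB (card_of_mem_baseSets hB1)
    refine ⟨hσi, fun ρ hρ hρE => ?_⟩
    have hcard : (Finset.univ.image ρ).card = d := by
      rw [Finset.card_image_of_injective _ hρ, Finset.card_fin]
    have h1 := tropicalMinor_le hρE rfl
    rw [ha _ hcard] at h1
    have h2 := (WithTop.add_ne_top.1 (ne_top_of_le_ne_top WithTop.coe_ne_top h1)).1
    rw [← coe_valReal h2, ← WithTop.coe_add, WithTop.coe_le_coe] at h1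
    have h3 := hB2 _ (mem_baseSets.2 h2)
    rw [Finset.sum_sub_distrib, Finset.sum_sub_distrib, sum_image_eq hσi hσB,
      sum_image_eq hρ rfl, hσ]
    linarith
  refine notMem_relSupp.2 ⟨hσE i, fun j hj => ?_⟩
  -- On a one-element ground set the element may be a coloop, but it is trivially minimal.
  rcases hz j with hj1 | ⟨B', hB', hjB'⟩
  · rw [hj1 (σ i)]
  obtain ⟨hB1, hB2⟩ := mem_initialSets.1 hB'
  have hBt := mem_baseSets.1 hB1
  have hm := ha B' (card_of_mem_baseSets hB1)
  obtain ⟨τ, hτE, hτB, hτ⟩ := exists_eq_tropicalMinor (a := a) (B := B') (by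
    rw [hm]; exact WithTop.add_ne_top.2 ⟨hBt, WithTop.coe_ne_top⟩)
  rw [hm, ← coe_valReal hBt, ← WithTop.coe_add, WithTop.coe_eq_coe] at hτ
  obtain ⟨hσi, hσo⟩ := hopt B hB σ hσB hσ
  obtain ⟨hτi, hτo⟩ := hopt B' hB' τ hτB hτ.symm
  refine le_of_optimal_assignment (E := fun i j => (a i).1 j ≠ ⊤)
    (c := fun i j => toReal (a i) j - z j) hσi hσE hσo hτi hτE hτo hj fun k hk => hjB' ?_
  rw [← hτB, ← hk]
  exact Finset.mem_image_of_mem _ (Finset.mem_univ k)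

end ValuatedMatroid

theorem sum_indicator_one_eq_ncard {α : Type*} (F : Set α) (B : Finset α) :
    ∑ i ∈ B, F.indicator (1 : α → ℝ) i = (((B : Set α) ∩ F).ncard : ℝ) := by
  classical
  have : (B : Set α) ∩ F = ((B.filter (· ∈ F) : Finset α) : Set α) := by ext; simp
  rw [this, Set.ncard_coe_finset, Finset.card_filter, Nat.cast_sum]
  refine Finset.sum_congr rfl fun i _ => ?_
  by_cases hi : i ∈ F <;> simp [hi]

theorem isBasis_inter_iff_ncard_le {α : Type*} {M : Matroid α} [M.Finite] {B F : Set α}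
    (hF : F ⊆ M.E) (hB : M.IsBase B) :
    M.IsBasis (B ∩ F) F ↔ ∀ B', M.IsBase B' → (B' ∩ F).ncard ≤ (B ∩ F).ncard := by
  have hfin : ∀ {B : Set α}, M.IsBase B → (B ∩ F).Finite := fun hB =>
    (M.ground_finite.subset hB.subset_ground).subset Set.inter_subset_left
  constructor
  · intro h B' hB'
    have h1 := (hB'.indep.subset (Set.inter_subset_left (t := F))).encard_le_eRk_of_subset
      Set.inter_subset_right
    rw [← h.encard_eq_eRk, ← (hfin hB).cast_ncard_eq, ← (hfin hB').cast_ncard_eq] at h1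
    exact_mod_cast h1
  · intro h
    obtain ⟨B', hB', hb⟩ := exists_isBase_inter_isBasis hF
    have hi := hB.indep.subset (Set.inter_subset_left (t := F))
    refine hi.isBasis_of_eRk_ge (hfin hB) Set.inter_subset_right ?_ hF
    rw [hi.eRk_eq_encard, ← hb.encard_eq_eRk, ← (hfin hB).cast_ncard_eq,
      ← (hfin hB').cast_ncard_eq]
    exact_mod_cast h B' hB'

theorem MatroidConnected.mem_closure_sdiff {α : Type*} {M : Matroid α} (hM : MatroidConnected M)
    {e f : α} (he : e ∈ M.E) (hf : f ∈ M.E) (hfe : f ≠ e) : e ∈ M.closure (M.E \ {e}) := by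
  obtain ⟨C, hC, heC, -⟩ := hM.2 e he f hf hfe.symm
  exact M.closure_subset_closure (Set.sdiff_subset_sdiff_left hC.subset_ground)
    (hC.mem_closure_sdiff_singleton_of_mem heC)

/-! ### Necessity of the counting conditions -/

namespace ValuatedMatroid

variable {n d : ℕ} {V : ValuatedMatroid n d} {x z : Fin n → ℝ} {F : Set (Fin n)}
  {B : Finset (Fin n)}

open TropVec

theorem isBasis_inter_iff_mem_argMin (hB : B ∈ initialSets V.baseSets V.valReal x) :
    (V.initial x).IsBasis ((B : Set (Fin n)) ∩ F) F ↔
      B ∈ argMin (initialSets V.baseSets V.valReal x)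
        (fun B => -∑ i ∈ B, F.indicator (1 : Fin n → ℝ) i) := by
  rw [isBasis_inter_iff_ncard_le (Set.subset_univ F) (initial_isBase_coe.2 hB), mem_argMin]
  simp only [hB, true_and, sum_indicator_one_eq_ncard, neg_le_neg_iff, Nat.cast_le]
  constructor
  · exact fun h B' hB' => h B' (initial_isBase_coe.2 hB')
  · intro h S hS
    obtain ⟨B', rfl, hB'⟩ := isBase_of_initial hS
    exact h B' hB'

theorem initial_eq_restrictSumContract (h : initialSets V.baseSets V.valReal z =
    argMin (initialSets V.baseSets V.valReal x)
      (fun B => -∑ i ∈ B, F.indicator (1 : Fin n → ℝ) i)) :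
    V.initial z = restrictSumContract (V.initial x) F := by
  have hF : F ⊆ (V.initial x).E := Set.subset_univ _
  refine ext_isBase_coe rfl (by rw [restrictSumContract_ground hF]; rfl) fun B => ?_
  rw [restrictSumContract_isBase_iff hF, initial_isBase_coe, initial_isBase_coe, h]
  constructor
  · intro hB
    exact ⟨argMin_subset hB, (isBasis_inter_iff_mem_argMin (argMin_subset hB)).2 hB⟩
  · rintro ⟨h1, h2⟩
    exact (isBasis_inter_iff_mem_argMin h1).1 h2

theorem exists_initial_add_eq (V : ValuatedMatroid n d) (x : Fin n → ℝ) (F : Set (Fin n)) :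
    ∃ ε > 0, V.initial (fun i => x i + ε * F.indicator (1 : Fin n → ℝ) i) =
      restrictSumContract (V.initial x) F := by
  obtain ⟨ε, hε, h⟩ := initialSets_perturb V.baseSets V.valReal x (F.indicator 1)
  exact ⟨ε, hε, initial_eq_restrictSumContract h⟩

theorem mem_initialSets_of_initial_eq {M : Matroid (Fin n)} (h : V.initial x = M)
    (hB : M.IsBase (B : Set (Fin n))) : B ∈ initialSets V.baseSets V.valReal x :=
  initial_isBase_coe.1 (h ▸ hB)

/-- Raising x by ε on F lowers y - x only on F, so a minimum attained in F stays a minimum. -/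
theorem mem_relSupp_of_mem_relSupp_add {p : TropProj n} {ε : ℝ} (hε : 0 < ε) {j : Fin n}
    (hj : j ∈ F) (h : j ∈ relSupp (fun i => x i + ε * F.indicator (1 : Fin n → ℝ) i) p) :
    j ∈ relSupp x p := by
  obtain ⟨y, rfl⟩ := Quotient.exists_rep p
  by_contra hjx
  obtain ⟨hjt, hmin⟩ := notMem_relSupp.1 hjx
  refine notMem_relSupp.2 ⟨hjt, fun k hk => ?_⟩ h
  have h1 := hmin k hk
  have h2 : F.indicator (1 : Fin n → ℝ) j = 1 := by simp [hj]
  have h3 : F.indicator (1 : Fin n → ℝ) k ≤ 1 := by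
    by_cases hk : k ∈ F <;> simp [hk]
  have h4 : ε * F.indicator (1 : Fin n → ℝ) k ≤ ε * 1 := mul_le_mul_of_nonneg_left h3 hε.le
  rw [h2]
  linarith

theorem regionInfty_subset_regionZero (V : ValuatedMatroid n d) (x : Fin n → ℝ)
    (F : Set (Fin n)) : V.regionInfty F (V.initial x) ⊆ V.regionZero F x := by
  intro p hp
  obtain ⟨ε, hε, h⟩ := V.exists_initial_add_eq x F
  obtain ⟨hL, hF⟩ := Set.mem_iInter₂.1 hp _ h
  exact ⟨hL, fun j hj => mem_relSupp_of_mem_relSupp_add hε hj (hF hj)⟩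

theorem exists_isBase_notMem_of_connected (hM : MatroidConnected (V.initial x)) (e : Fin n) :
    (∀ j, j = e) ∨ e ∈ (V.initial x).closure ((V.initial x).E \ {e}) := by
  by_cases h : ∀ j, j = e
  · exact Or.inl h
  · push Not at h
    obtain ⟨f, hf⟩ := h
    exact Or.inr (hM.mem_closure_sdiff (Set.mem_univ e) (Set.mem_univ f) hf)

theorem exists_assignment_of_presentation {a : Fin d → TropVec n} {c : ℝ}
    (ha : ∀ B : Finset (Fin n), B.card = d →
      tropicalMinor (fun i => (a i).1) B = V.val B + (c : WithTop ℝ)) (hB : B ∈ V.baseSets) :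
    ∃ σ : Fin d → Fin n, (∀ i, (a i).1 (σ i) ≠ ⊤) ∧ Finset.univ.image σ = B ∧
      ∑ i, toReal (a i) (σ i) = V.valReal B + c := by
  have hBt := mem_baseSets.1 hB
  have hm := ha B (card_of_mem_baseSets hB)
  obtain ⟨τ, hτE, hτB, hτ⟩ := exists_eq_tropicalMinor (a := a) (B := B) (by
    rw [hm]; exact WithTop.add_ne_top.2 ⟨hBt, WithTop.coe_ne_top⟩)
  rw [hm, ← coe_valReal hBt, ← WithTop.coe_add, WithTop.coe_eq_coe] at hτ
  exact ⟨τ, hτE, hτB, hτ.symm⟩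

theorem encard_setOf_notMem_eq {σ : Fin d → Fin n} (hσ : Function.Injective σ)
    (hB : Finset.univ.image σ = B) (F : Set (Fin n)) :
    {i | σ i ∉ F}.encard = ((B : Set (Fin n)) \ F).encard := by
  rw [← hσ.encard_image]
  congr 1
  ext j
  rw [← hB]
  simp only [Set.mem_image, Set.mem_ofPred_eq, Set.mem_sdiff, Finset.coe_image, Finset.coe_univ,
    Set.image_univ, Set.mem_range]
  constructor
  · rintro ⟨i, hi, rfl⟩
    exact ⟨⟨i, rfl⟩, hi⟩
  · rintro ⟨⟨i, rfl⟩, hi⟩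
    exact ⟨i, hi, rfl⟩

theorem countIn_regionZero_le_of_presentation {a : Fin d → TropVec n} {c : ℝ}
    (ha : ∀ B : Finset (Fin n), B.card = d →
      tropicalMinor (fun i => (a i).1) B = V.val B + (c : WithTop ℝ))
    (hM : MatroidConnected (V.initial x)) (F : Set (Fin n)) :
    countIn (fun i => Quotient.mk _ (a i)) (V.regionZero F x) ≤ matroidCorank (V.initial x) F := by
  obtain ⟨S, hS, hSF⟩ := exists_isBase_inter_isBasis (M := V.initial x) (F := F)
    (Set.subset_univ F)
  rw [matroidCorank_eq_encard hS hSF]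
  obtain ⟨B, rfl, hB⟩ := isBase_of_initial hS
  have hBs := (mem_initialSets.1 hB).1
  obtain ⟨σ, hσE, hσB, hσ⟩ := exists_assignment_of_presentation ha hBs
  rw [← encard_setOf_notMem_eq (injective_of_image_eq hσB (card_of_mem_baseSets hBs)) hσB]
  refine Set.encard_le_encard fun i hi hiF => ?_
  refine notMem_relSupp_of_presentation ha hB hσE hσB hσ (fun e => ?_) i (hi.2 hiF)
  refine (exists_isBase_notMem_of_connected hM e).imp_right fun he => ?_
  obtain ⟨S, hS, -, heS⟩ := exists_isBase_notMem_inter_isBasis (Set.empty_subset _) he (by simp)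
  obtain ⟨B', rfl, hB'⟩ := isBase_of_initial hS
  exact ⟨B', hB', heS⟩

/-- One optimal matching σ serves all points of the cell of M|F ⊕ M/F, and the cork(F) rows that it
matches outside F all lie in R_∞. -/
theorem le_countIn_regionInfty_of_presentation {a : Fin d → TropVec n} {c : ℝ}
    (ha : ∀ B : Finset (Fin n), B.card = d →
      tropicalMinor (fun i => (a i).1) B = V.val B + (c : WithTop ℝ))
    (hA : ∀ i, (Quotient.mk _ (a i) : TropProj n) ∈ V.linearSpace)
    (hM : MatroidConnected (V.initial x)) (hF : IsCyclicFlat (V.initial x) F) :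
    matroidCorank (V.initial x) F ≤
      countIn (fun i => Quotient.mk _ (a i)) (V.regionInfty F (V.initial x)) := by
  have hFE : F ⊆ (V.initial x).E := Set.subset_univ F
  obtain ⟨S, hS, hSF⟩ := exists_isBase_inter_isBasis hFE
  rw [matroidCorank_eq_encard hS hSF]
  obtain ⟨B, rfl, hB⟩ := isBase_of_initial hS
  have hBs := (mem_initialSets.1 hB).1
  obtain ⟨σ, hσE, hσB, hσ⟩ := exists_assignment_of_presentation ha hBs
  rw [← encard_setOf_notMem_eq (injective_of_image_eq hσB (card_of_mem_baseSets hBs)) hσB]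
  have hrow : ∀ z, V.initial z = restrictSumContract (V.initial x) F → ∀ i,
      σ i ∉ relSupp z (Quotient.mk _ (a i)) := by
    intro z hz i
    refine notMem_relSupp_of_presentation ha (mem_initialSets_of_initial_eq hz
      ((restrictSumContract_isBase_iff hFE).2 ⟨hS, hSF⟩)) hσE hσB hσ (fun e => ?_) i
    refine (exists_isBase_notMem_of_connected hM e).imp_right fun he => ?_
    obtain ⟨S', hS', hSF', heS'⟩ := exists_isBase_notMem_inter_isBasis hFE he fun heF => by
      obtain ⟨T, hT, hTF, heT⟩ := ((isCyclicFlat_iff_exists_isBase hFE).1 hF).2 e heF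
      refine (V.initial x).closure_subset_closure (X := T ∩ F) ?_ ?_
      · exact fun k hk => ⟨hk.2, fun hke => heT (hke ▸ hk.1)⟩
      · rw [hTF.closure_eq_closure]
        exact (V.initial x).subset_closure F hFE heF
    obtain ⟨B', rfl⟩ := S'.toFinite.exists_finset_coe
    exact ⟨B', mem_initialSets_of_initial_eq hz
      ((restrictSumContract_isBase_iff hFE).2 ⟨hS', hSF'⟩), heS'⟩
  refine Set.encard_le_encard fun i hi => Set.mem_iInter₂.2 fun z hz => ⟨hA i, fun j hj => ?_⟩
  have hz : V.initial z = restrictSumContract (V.initial x) F := hz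
  by_contra hjz
  -- The bases at z all meet F maximally, so a small step along e_F stays in the cell. After it, an
  -- entry in F that was minimal at z would beat `σ i` strictly, against `hrow`.
  have hcell : ∃ ε > 0, V.initial (fun i => z i + ε * F.indicator (1 : Fin n → ℝ) i) =
      restrictSumContract (V.initial x) F := by
    obtain ⟨ε, hε, h⟩ := V.exists_initial_add_eq z F
    refine ⟨ε, hε, h.trans ?_⟩
    have hFz : F ⊆ (V.initial z).E := Set.subset_univ F
    refine ext_isBase_coe (by rw [restrictSumContract_ground hFz]; rfl)
      (by rw [restrictSumContract_ground hFE]; rfl) fun B' => ?_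
    rw [restrictSumContract_isBase_iff hFz, hz]
    refine and_iff_left_of_imp fun hB' => ?_
    rw [← hz]
    have hB'z : (V.initial z).IsBase (B' : Set (Fin n)) := hz ▸ hB'
    rw [isBasis_inter_iff_ncard_le hFz hB'z]
    intro T hT
    rw [hz, restrictSumContract_isBase_iff hFE] at hT
    exact (isBasis_inter_iff_ncard_le hFE ((restrictSumContract_isBase_iff hFE).1 hB').1).1
      ((restrictSumContract_isBase_iff hFE).1 hB').2 T hT.1
  obtain ⟨ε, hε, h⟩ := hcell
  obtain ⟨hjt, hjmin⟩ := notMem_relSupp.1 hjz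
  have h1 := (notMem_relSupp.1 (hrow _ h i)).2 j hjt
  have h2 := hjmin (σ i) (hσE i)
  have h3 : F.indicator (1 : Fin n → ℝ) j = 1 := by simp [hj]
  have h4 : F.indicator (1 : Fin n → ℝ) (σ i) = 0 := Set.indicator_of_notMem hi _
  rw [h3, h4] at h1
  linarith

end ValuatedMatroid

/-! ### Sufficiency: the minors at bases of V -/

namespace ValuatedMatroid

variable {n d : ℕ} {V : ValuatedMatroid n d} {x v : Fin n → ℝ} {F : Set (Fin n)}
  {B : Finset (Fin n)} {a : Fin d → TropVec n}

open TropVec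

/-- A connected matroid with two elements has no loops; on a single element, a loop means rank 0,
and then it is a loop of V too. -/
theorem initial_mem_initialMatroids_of_connected (hM : MatroidConnected (V.initial x)) :
    V.initial x ∈ V.initialMatroids := by
  refine ⟨⟨x, rfl⟩, fun e he => ?_⟩
  have he : (V.initial x).IsLoop e := he
  by_cases hne : ∀ f, f = e
  · change V.underlying.IsLoop e
    rw [isLoop_iff_forall_notMem_isBase (Set.mem_univ e)]
    rw [isLoop_iff_forall_notMem_isBase (Set.mem_univ e)] at he
    intro S hS heS
    obtain ⟨B, rfl⟩ := S.toFinite.exists_finset_coe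
    obtain ⟨T, hT⟩ := (V.initial x).exists_isBase
    obtain ⟨B', rfl, hB'⟩ := isBase_of_initial hT
    have h1 := card_of_mem_baseSets (underlying_isBase_coe.1 hS)
    have h2 := card_of_mem_baseSets (mem_initialSets.1 hB').1
    have h3 : 0 < B.card := Finset.card_pos.2 ⟨e, heS⟩
    obtain ⟨f, hf⟩ := Finset.card_pos.1 (h2 ▸ h1 ▸ h3 : 0 < B'.card)
    exact he _ hT (hne f ▸ hf)
  · push Not at hne
    obtain ⟨f, hf⟩ := hne
    obtain ⟨C, hC, heC, hfC⟩ := hM.2 e (Set.mem_univ e) f (Set.mem_univ f) hf.symm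
    have := he.isCircuit.eq_of_subset_isCircuit hC (Set.singleton_subset_iff.2 heC)
    rw [← this] at hfC
    exact absurd hfC hf

/-- Every initial matroid is contained in a connected one. -/
theorem exists_connected_initialSets_superset (hV : MatroidConnected V.underlying)
    (x : Fin n → ℝ) : ∃ v, initialSets V.baseSets V.valReal x ⊆
      initialSets V.baseSets V.valReal v ∧ MatroidConnected (V.initial v) := by
  obtain ⟨v, hxv, hv⟩ := exists_initialSets_superset (ω := V.valReal) baseSets_nonempty x
  -- If |B ∩ S| is constant on the initial bases at v, it is constant on all bases of V by the
  -- choice of v.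
  refine ⟨v, hxv, matroidConnected_of_forall_separator hV.1 fun S hS e _ f _ heS => ?_⟩
  obtain ⟨T, hT⟩ := (V.initial v).exists_isBase
  refine mem_iff_of_forall_ncard_inter_eq hV (S := S) (fun T₁ T₂ h₁ h₂ => ?_)
    (Set.mem_univ e) (Set.mem_univ f) heS
  obtain ⟨B₁, rfl⟩ := T₁.toFinite.exists_finset_coe
  obtain ⟨B₂, rfl⟩ := T₂.toFinite.exists_finset_coe
  have key := hv (S.indicator 1) (T ∩ S).ncard fun B hB => by
    rw [sum_indicator_one_eq_ncard, hS _ _ (initial_isBase_coe.2 hB) hT]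
  have k₁ := key B₁ (underlying_isBase_coe.1 h₁)
  have k₂ := key B₂ (underlying_isBase_coe.1 h₂)
  rw [sum_indicator_one_eq_ncard, ← k₂, sum_indicator_one_eq_ncard] at k₁
  exact_mod_cast k₁

/-- Choose x so that B and B' have equal height. A large multiple of e_{B ∩ B'} + e_{B ∪ B'} favours
exactly the bases between B ∩ B' and B ∪ B', and these are only the two. -/
theorem exists_mem_initialSets_pair {B' : Finset (Fin n)} (hB : B ∈ V.baseSets)
    (hB' : B' ∈ V.baseSets) (h : ∀ C : Finset (Fin n), C.card = d → B ∩ B' ⊆ C → C ⊆ B ∪ B' →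
      C = B ∨ C = B') : ∃ x, B ∈ initialSets V.baseSets V.valReal x ∧
        B' ∈ initialSets V.baseSets V.valReal x := by
  have hx : ∃ x : Fin n → ℝ, V.valReal B - ∑ i ∈ B, x i = V.valReal B' - ∑ i ∈ B', x i := by
    by_cases hsub : B' ⊆ B
    · have : B' = B := Finset.eq_of_subset_of_card_le hsub
        (by rw [card_of_mem_baseSets hB, card_of_mem_baseSets hB'])
      exact ⟨0, by rw [this]⟩
    · obtain ⟨b, hb', hb⟩ := Finset.not_subset.1 hsub
      refine ⟨Pi.single b (V.valReal B' - V.valReal B), ?_⟩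
      rw [Finset.sum_pi_single', Finset.sum_pi_single', if_neg hb, if_pos hb']
      ring
  obtain ⟨x, hx⟩ := hx
  set g : Fin n → ℝ := fun i => ((↑(B ∩ B') : Set (Fin n)).indicator (1 : Fin n → ℝ) i +
    (↑(B ∪ B') : Set (Fin n)).indicator (1 : Fin n → ℝ) i) with hg
  have hgsum : ∀ C : Finset (Fin n),
      ∑ i ∈ C, g i = (((C ∩ (B ∩ B')).card + (C ∩ (B ∪ B')).card : ℕ) : ℝ) := by
    intro C
    rw [hg, Finset.sum_add_distrib, sum_indicator_one_eq_ncard, sum_indicator_one_eq_ncard,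
      ← Finset.coe_inter, ← Finset.coe_inter, Set.ncard_coe_finset, Set.ncard_coe_finset]
    push_cast
    rfl
  have hval : ∀ C : Finset (Fin n), C.card = d → B ∩ B' ⊆ C → C ⊆ B ∪ B' →
      (C ∩ (B ∩ B')).card + (C ∩ (B ∪ B')).card = (B ∩ B').card + d := fun C hC h1 h2 => by
    rw [Finset.inter_eq_right.2 h1, Finset.inter_eq_left.2 h2, hC]
  have hle1 : ∀ C : Finset (Fin n), (C ∩ (B ∩ B')).card ≤ (B ∩ B').card :=
    fun C => Finset.card_le_card Finset.inter_subset_right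
  have hle2 : ∀ C : Finset (Fin n), (C ∩ (B ∪ B')).card ≤ C.card :=
    fun C => Finset.card_le_card Finset.inter_subset_left
  have hBd := card_of_mem_baseSets hB
  have hBd' := card_of_mem_baseSets hB'
  have hBv := hval B hBd Finset.inter_subset_left Finset.subset_union_left
  have hBv' := hval B' hBd' Finset.inter_subset_right Finset.subset_union_right
  set K := argMin V.baseSets (fun B => -∑ i ∈ B, g i) with hK
  have hmemK : ∀ C, C ∈ K ↔ C = B ∨ C = B' := by
    intro C
    have hmax : ∀ D ∈ V.baseSets, (C = B ∨ C = B') →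
        (D ∩ (B ∩ B')).card + (D ∩ (B ∪ B')).card ≤
          (C ∩ (B ∩ B')).card + (C ∩ (B ∪ B')).card := by
      intro D hD hC
      have h1 := hle1 D
      have h2 := hle2 D
      have h3 := card_of_mem_baseSets hD
      rcases hC with rfl | rfl <;> omega
    rw [hK, mem_argMin]
    simp only [hgsum, neg_le_neg_iff, Nat.cast_le]
    constructor
    · rintro ⟨hC, hmin⟩
      have h0 := card_of_mem_baseSets hC
      have h1 := hmin B hB
      have h2 := hle1 C
      have h3 := hle2 C
      refine h C h0 (Finset.inter_eq_right.1 ?_) (Finset.inter_eq_left.1 ?_)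
      · exact Finset.eq_of_subset_of_card_le Finset.inter_subset_right (by omega)
      · exact Finset.eq_of_subset_of_card_le Finset.inter_subset_left (by omega)
    · intro hC
      refine ⟨?_, fun D hD => hmax D hD hC⟩
      rcases hC with rfl | rfl
      · exact hB
      · exact hB'
  obtain ⟨t, -, ht⟩ := initialSets_perturb_large V.baseSets V.valReal x g
  refine ⟨_, ht ▸ mem_initialSets.2 ⟨(hmemK B).2 (Or.inl rfl), fun C hC => ?_⟩,
    ht ▸ mem_initialSets.2 ⟨(hmemK B').2 (Or.inr rfl), fun C hC => ?_⟩⟩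
  · rcases (hmemK C).1 hC with rfl | rfl
    · exact le_rfl
    · exact hx.le
  · rcases (hmemK C).1 hC with rfl | rfl
    · exact hx.ge
    · exact le_rfl

/-- If the counting inequalities for flats hold at `v`, then every base of the initial matroid
at `v` is assigned to the rows in such a way that only minimal entries are used. -/
theorem exists_assignment_of_countIn_le
    (hA : ∀ i, (Quotient.mk _ (a i) : TropProj n) ∈ V.linearSpace)
    (h : ∀ F, (V.initial v).IsFlat F →
      countIn (fun i => Quotient.mk _ (a i)) (V.regionZero F v) ≤ matroidCorank (V.initial v) F)
    (hB : B ∈ initialSets V.baseSets V.valReal v) :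
    ∃ ρ : Fin d → Fin n, Finset.univ.image ρ = B ∧
      ∀ i, ρ i ∉ relSupp v (Quotient.mk _ (a i)) := by
  classical
  have hBs := (mem_initialSets.1 hB).1
  set t : Fin d → Finset (Fin n) :=
    fun i => B.filter fun j => j ∉ relSupp v (Quotient.mk _ (a i)) with ht
  have hall : ∀ I : Finset (Fin d), I.card ≤ (I.biUnion t).card := by
    intro I
    rcases I.eq_empty_or_nonempty with rfl | hI
    · simp
    have : Nonempty I := hI.to_subtype
    -- All rows of I lie in R_0 of this flat, and their admissible columns form B \ F, of size at
    -- least cork(F); this is Hall's condition.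
    set F : Set (Fin n) := ⋂ i : I, relSupp v (Quotient.mk _ (a i)) with hF
    have hflat : (V.initial v).IsFlat F := IsFlat.iInter fun i => isFlat_relSupp (hA i) v
    have h1 : (I.card : ℕ∞) ≤ countIn (fun i => Quotient.mk _ (a i)) (V.regionZero F v) := by
      rw [countIn, ← Set.encard_coe_eq_coe_finsetCard]
      refine Set.encard_le_encard fun i hi => ⟨hA i, ?_⟩
      exact Set.iInter_subset (fun i : I => relSupp v (Quotient.mk _ (a i))) ⟨i, hi⟩
    obtain ⟨S, hS, hSF⟩ := exists_isBase_inter_isBasis (M := V.initial v) (F := F)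
      (Set.subset_univ F)
    have h2 := h1.trans (h F hflat)
    rw [matroidCorank_eq_encard hS hSF] at h2
    have h3 := (isBasis_inter_iff_ncard_le (Set.subset_univ F) hS).1 hSF _
      (initial_isBase_coe.2 hB)
    obtain ⟨B', rfl, hB'⟩ := isBase_of_initial hS
    have h4 : (B : Set (Fin n)) \ F = (I.biUnion t : Finset (Fin n)) := by
      ext j
      simp [hF, ht]
    rw [← (Set.toFinite ((B' : Set (Fin n)) \ F)).cast_ncard_eq, Nat.cast_le] at h2
    have h5 := Set.ncard_inter_add_ncard_sdiff_eq_ncard (B : Set (Fin n)) F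
    have h6 := Set.ncard_inter_add_ncard_sdiff_eq_ncard (B' : Set (Fin n)) F
    rw [h4, Set.ncard_coe_finset, Set.ncard_coe_finset, card_of_mem_baseSets hBs] at h5
    rw [Set.ncard_coe_finset, card_of_mem_baseSets (mem_initialSets.1 hB').1] at h6
    omega
  obtain ⟨ρ, hρ, hρt⟩ := (Finset.all_card_le_biUnion_card_iff_exists_injective t).1 hall
  refine ⟨ρ, Finset.eq_of_subset_of_card_le (fun j hj => ?_) ?_,
    fun i => (Finset.mem_filter.1 (hρt i)).2⟩
  · obtain ⟨i, -, rfl⟩ := Finset.mem_image.1 hj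
    exact (Finset.mem_filter.1 (hρt i)).1
  · rw [Finset.card_image_of_injective _ hρ, Finset.card_fin, card_of_mem_baseSets hBs]

/-- Relative to v, a matching through row-minimal entries costs the sum of the row minima, whatever
the base. The constant is this sum minus the least height at v. -/
theorem exists_tropicalMinor_eq_of_countIn_le
    (hA : ∀ i, (Quotient.mk _ (a i) : TropProj n) ∈ V.linearSpace)
    (h : ∀ F, (V.initial v).IsFlat F →
      countIn (fun i => Quotient.mk _ (a i)) (V.regionZero F v) ≤ matroidCorank (V.initial v) F) :
    ∃ c : ℝ, ∀ B ∈ initialSets V.baseSets V.valReal v,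
      tropicalMinor (fun i => (a i).1) B = ((V.valReal B + c : ℝ) : WithTop ℝ) := by
  obtain ⟨B₀, hB₀⟩ : (initialSets V.baseSets V.valReal v).Nonempty :=
    argMin_nonempty baseSets_nonempty _
  obtain ⟨ρ₀, -, hρ₀⟩ := exists_assignment_of_countIn_le hA h hB₀
  have hE₀ : ∀ i, (a i).1 (ρ₀ i) ≠ ⊤ := fun i => (notMem_relSupp.1 (hρ₀ i)).1
  refine ⟨∑ i, (toReal (a i) (ρ₀ i) - v (ρ₀ i)) - (V.valReal B₀ - ∑ i ∈ B₀, v i),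
    fun B hB => ?_⟩
  obtain ⟨hBs, hBm⟩ := mem_initialSets.1 hB
  obtain ⟨hBs₀, hBm₀⟩ := mem_initialSets.1 hB₀
  have hBB := le_antisymm (hBm B₀ hBs₀) (hBm₀ B hBs)
  obtain ⟨ρ, hρB, hρ⟩ := exists_assignment_of_countIn_le hA h hB
  have hE : ∀ i, (a i).1 (ρ i) ≠ ⊤ := fun i => (notMem_relSupp.1 (hρ i)).1
  have hcard := card_of_mem_baseSets hBs
  have h1 := tropicalMinor_le hE hρB
  obtain ⟨τ, hτE, hτB, hτ⟩ := exists_eq_tropicalMinor (ne_top_of_le_ne_top WithTop.coe_ne_top h1)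
  rw [hτ, WithTop.coe_le_coe] at h1
  rw [hτ, WithTop.coe_eq_coe]
  have h2 : ∑ i, (toReal (a i) (ρ i) - v (ρ i)) = ∑ i, (toReal (a i) (ρ₀ i) - v (ρ₀ i)) :=
    Finset.sum_congr rfl fun i _ => le_antisymm ((notMem_relSupp.1 (hρ i)).2 _ (hE₀ i))
      ((notMem_relSupp.1 (hρ₀ i)).2 _ (hE i))
  have h3 : ∑ i, (toReal (a i) (ρ i) - v (ρ i)) ≤ ∑ i, (toReal (a i) (τ i) - v (τ i)) :=
    Finset.sum_le_sum fun i _ => (notMem_relSupp.1 (hρ i)).2 _ (hτE i)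
  have h4 := h2
  rw [Finset.sum_sub_distrib, Finset.sum_sub_distrib,
    sum_image_eq (injective_of_image_eq hρB hcard) hρB,
    sum_image_eq (injective_of_image_eq hτB hcard) hτB] at h3
  rw [Finset.sum_sub_distrib, sum_image_eq (injective_of_image_eq hρB hcard) hρB] at h4
  linarith

theorem exists_tropicalMinor_eq_on_baseSets (hV : MatroidConnected V.underlying)
    (h : ∀ v, MatroidConnected (V.initial v) → ∃ c : ℝ,
      ∀ B ∈ initialSets V.baseSets V.valReal v,
        tropicalMinor (fun i => (a i).1) B = ((V.valReal B + c : ℝ) : WithTop ℝ)) :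
    ∃ c : ℝ, ∀ B ∈ V.baseSets,
      tropicalMinor (fun i => (a i).1) B = ((V.valReal B + c : ℝ) : WithTop ℝ) := by
  classical
  have hpair : ∀ B ∈ V.baseSets, ∀ B' ∈ V.baseSets, (∀ C : Finset (Fin n), C.card = d →
      B ∩ B' ⊆ C → C ⊆ B ∪ B' → C = B ∨ C = B') → ∃ c : ℝ,
      tropicalMinor (fun i => (a i).1) B = ((V.valReal B + c : ℝ) : WithTop ℝ) ∧
      tropicalMinor (fun i => (a i).1) B' = ((V.valReal B' + c : ℝ) : WithTop ℝ) := by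
    intro B hB B' hB' hBB'
    obtain ⟨x, hx, hx'⟩ := exists_mem_initialSets_pair hB hB' hBB'
    obtain ⟨v, hxv, hv⟩ := exists_connected_initialSets_superset hV x
    obtain ⟨c, hc⟩ := h v hv
    exact ⟨c, hc B (hxv hx), hc B' (hxv hx')⟩
  set φ : Set (Fin n) → ℝ := fun S =>
    (tropicalMinor (fun i => (a i).1) S.toFinset).untopD 0 - V.valReal S.toFinset with hφ
  have hφB : ∀ B : Finset (Fin n), φ B =
      (tropicalMinor (fun i => (a i).1) B).untopD 0 - V.valReal B := fun B => by
    simp [hφ]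
  have hφc : ∀ (B : Finset (Fin n)) (c : ℝ),
      tropicalMinor (fun i => (a i).1) B = ((V.valReal B + c : ℝ) : WithTop ℝ) → φ B = c := by
    intro B c hc
    rw [hφB, hc, WithTop.untopD_coe]
    ring
  obtain ⟨B₀, hB₀⟩ := V.baseSets_nonempty
  refine ⟨φ B₀, fun B hB => ?_⟩
  -- The pair B, B shows that the minor at B is finite, so the default of `untopD` in `φ` plays no
  -- role.
  obtain ⟨c, hc, -⟩ := hpair B hB B hB fun C _ h1 h2 => Or.inl <| by
    rw [Finset.inter_self] at h1
    rw [Finset.union_self] at h2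
    exact h2.antisymm h1
  rw [hc, ← hφc B c hc]
  congr 2
  refine isBase_induction_exchange φ (fun S e f hS he hf hS' => ?_)
    (underlying_isBase_coe.2 hB) (underlying_isBase_coe.2 hB₀)
  obtain ⟨B₁, rfl⟩ := S.toFinite.exists_finset_coe
  have he : e ∈ B₁ := he
  have hf : f ∉ B₁ := hf
  have hcoe : insert f ((B₁ : Set (Fin n)) \ {e}) =
      ((insert f (B₁.erase e) : Finset (Fin n)) : Set (Fin n)) := by simp
  rw [hcoe] at hS' ⊢
  have hB₁ := underlying_isBase_coe.1 hS
  have hB₂ := underlying_isBase_coe.1 hS'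
  have hfe : f ≠ e := fun h => hf (h ▸ he)
  obtain ⟨c, h1, h2⟩ := hpair B₁ hB₁ _ hB₂ fun C hC h1 h2 => by
    have hcard := card_of_mem_baseSets hB₁
    have hsub : B₁.erase e ⊆ C := fun k hk => h1 (Finset.mem_inter.2
      ⟨Finset.mem_of_mem_erase hk, Finset.mem_insert_of_mem hk⟩)
    by_cases heC : e ∈ C
    · left
      refine (Finset.eq_of_subset_of_card_le (fun k hk => ?_) (by omega)).symm
      by_cases hke : k = e
      · exact hke ▸ heC
      · exact hsub (Finset.mem_erase.2 ⟨hke, hk⟩)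
    · right
      refine Finset.eq_of_subset_of_card_le (fun k hk => ?_)
        (by rw [card_of_mem_baseSets hB₂, hC])
      rcases Finset.mem_union.1 (h2 hk) with h3 | h3
      · exact Finset.mem_insert_of_mem (Finset.mem_erase.2 ⟨fun h => heC (h ▸ hk), h3⟩)
      · exact h3
  rw [hφc _ c h1, hφc _ c h2]

end ValuatedMatroid

/-! ### Sufficiency: the minors at non-bases -/

namespace ValuatedMatroid

variable {n d : ℕ} {V : ValuatedMatroid n d} {x v : Fin n → ℝ} {F : Set (Fin n)}
  {B : Finset (Fin n)} {a : Fin d → TropVec n}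

open TropVec

theorem underlying_isBasis_inter_iff_mem_argMin (hB : B ∈ V.baseSets) :
    V.underlying.IsBasis ((B : Set (Fin n)) ∩ F) F ↔
      B ∈ argMin V.baseSets (fun B => -∑ i ∈ B, F.indicator (1 : Fin n → ℝ) i) := by
  rw [isBasis_inter_iff_ncard_le (Set.subset_univ F) (underlying_isBase_coe.2 hB), mem_argMin]
  simp only [hB, true_and, sum_indicator_one_eq_ncard, neg_le_neg_iff, Nat.cast_le]
  constructor
  · exact fun h B' hB' => h B' (underlying_isBase_coe.2 hB')
  · intro h S hS
    obtain ⟨B', rfl⟩ := S.toFinite.exists_finset_coe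
    exact h B' (underlying_isBase_coe.1 hS)

/-- A cyclic flat of the underlying matroid is a cyclic flat of some connected initial matroid,
with the same rank. -/
theorem exists_connected_isCyclicFlat (hV : MatroidConnected V.underlying)
    (hF : IsCyclicFlat V.underlying F) :
    ∃ v, MatroidConnected (V.initial v) ∧ IsCyclicFlat (V.initial v) F ∧
      ∃ B ∈ initialSets V.baseSets V.valReal v,
        B ∈ argMin V.baseSets (fun B => -∑ i ∈ B, F.indicator (1 : Fin n → ℝ) i) := by
  set K := argMin V.baseSets (fun B => -∑ i ∈ B, F.indicator (1 : Fin n → ℝ) i) with hK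
  have hKne : K.Nonempty := argMin_nonempty baseSets_nonempty _
  -- K consists of the bases of M|F ⊕ M/F for M = `V.underlying`. By the choice of x₁, an element in
  -- none (or all) of the initial sets of K there is in none (or all) of K; applied to coordinate
  -- forms, this transfers cyclic flatness.
  obtain ⟨x₁, -, hx₁⟩ := exists_initialSets_superset (ω := V.valReal) hKne 0
  obtain ⟨t, -, ht⟩ := initialSets_perturb_large V.baseSets V.valReal x₁ (F.indicator 1)
  rw [← hK] at ht
  obtain ⟨v, hv, hconn⟩ := exists_connected_initialSets_superset hV
    (fun i => x₁ i + t * F.indicator (1 : Fin n → ℝ) i)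
  rw [ht] at hv
  have hFU : F ⊆ V.underlying.E := Set.subset_univ F
  have hfull : ∀ B ∈ initialSets K V.valReal x₁, (V.initial v).IsBase (B : Set (Fin n)) ∧
      (V.initial v).IsBasis ((B : Set (Fin n)) ∩ F) F := by
    intro B hB
    have hBv := hv hB
    refine ⟨initial_isBase_coe.2 hBv, (isBasis_inter_iff_mem_argMin hBv).2
      (mem_argMin.2 ⟨hBv, fun B' hB' => ?_⟩)⟩
    exact (mem_argMin.1 (argMin_subset hB : B ∈ K)).2 B' (mem_initialSets.1 hB').1
  have hsing : ∀ (e : Fin n) (B : Finset (Fin n)),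
      ∑ i ∈ B, (Pi.single e 1 : Fin n → ℝ) i = if e ∈ B then 1 else 0 :=
    fun e B => by rw [Finset.sum_pi_single']
  obtain ⟨hF₁, hF₂⟩ := (isCyclicFlat_iff_exists_isBase hFU).1 hF
  refine ⟨v, hconn, (isCyclicFlat_iff_exists_isBase (Set.subset_univ F)).2 ⟨fun e he => ?_,
    fun e he => ?_⟩, ?_⟩
  · obtain ⟨S, hS, hSF, heS⟩ := hF₁ e he
    obtain ⟨B, rfl⟩ := S.toFinite.exists_finset_coe
    have hBK := (underlying_isBasis_inter_iff_mem_argMin (underlying_isBase_coe.1 hS)).1 hSF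
    by_contra hcon
    push Not at hcon
    have := hx₁ (Pi.single e 1) 0 (fun B' hB' => by
      obtain ⟨h1, h2⟩ := hfull B' hB'
      rw [hsing, if_neg fun h => hcon _ h1 h2 (Finset.mem_coe.2 h)]) B hBK
    rw [hsing, if_pos (Finset.mem_coe.1 heS)] at this
    exact one_ne_zero this
  · obtain ⟨S, hS, hSF, heS⟩ := hF₂ e he
    obtain ⟨B, rfl⟩ := S.toFinite.exists_finset_coe
    have hBK := (underlying_isBasis_inter_iff_mem_argMin (underlying_isBase_coe.1 hS)).1 hSF
    by_contra hcon
    push Not at hcon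
    have := hx₁ (Pi.single e 1) 1 (fun B' hB' => by
      obtain ⟨h1, h2⟩ := hfull B' hB'
      rw [hsing, if_pos (Finset.mem_coe.1 (hcon _ h1 h2))]) B hBK
    rw [hsing, if_neg fun h => heS (Finset.mem_coe.2 h)] at this
    exact zero_ne_one this
  · obtain ⟨B, hB⟩ : (initialSets K V.valReal x₁).Nonempty := argMin_nonempty hKne _
    exact ⟨B, hv hB, argMin_subset hB⟩

/-- If the cell of `M|F ⊕ M/F` contains the whole ray `v + t e_F`, `t > 0`, then the points of
`R_∞(F, v, L)` have the coordinates `∞` on `F`. -/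
theorem eq_top_of_mem_regionInfty {y : TropVec n}
    (hray : ∀ t > 0, V.initial (fun i => v i + t * F.indicator (1 : Fin n → ℝ) i) =
      restrictSumContract (V.initial v) F)
    (hy : Quotient.mk _ y ∈ V.regionInfty F (V.initial v)) {j : Fin n} (hj : j ∈ F) :
    y.1 j = ⊤ := by
  classical
  by_contra hjt
  obtain ⟨m, hm, hmin⟩ := Finset.exists_min_image
    (Finset.univ.filter fun k => k ∈ F ∧ y.1 k ≠ ⊤) (fun k => toReal y k - v k)
    ⟨j, by simpa using ⟨hj, hjt⟩⟩
  simp only [Finset.mem_filter, Finset.mem_univ, true_and] at hm hmin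
  -- So large that at v + t e_F the entry m ∈ F is below every entry outside F.
  set t := |toReal y m - v m| + ∑ k, |toReal y k - v k| + 1 with ht
  have hs : 0 ≤ ∑ k, |toReal y k - v k| := Finset.sum_nonneg fun k _ => abs_nonneg _
  have ht0 : 0 < t := by positivity
  have hmem := (Set.mem_iInter₂.1 hy _ (hray t ht0)).2 hm.1
  refine notMem_relSupp.2 ⟨hm.2, fun k hk => ?_⟩ hmem
  have h1 : F.indicator (1 : Fin n → ℝ) m = 1 := by simp [hm.1]
  by_cases hkF : k ∈ F
  · have h2 : F.indicator (1 : Fin n → ℝ) k = 1 := by simp [hkF]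
    rw [h1, h2]
    linarith [hmin k ⟨hkF, hk⟩]
  · have h2 : F.indicator (1 : Fin n → ℝ) k = 0 := by simp [hkF]
    have h3 : |toReal y k - v k| ≤ ∑ k, |toReal y k - v k| :=
      Finset.single_le_sum (f := fun k => |toReal y k - v k|) (fun k _ => abs_nonneg _)
        (Finset.mem_univ k)
    rw [h1, h2]
    linarith [le_abs_self (toReal y m - v m), neg_abs_le (toReal y k - v k)]

theorem tropicalMinor_eq_top_of_countIn (hV : MatroidConnected V.underlying)
    (h : ∀ v, MatroidConnected (V.initial v) → ∀ F, IsCyclicFlat (V.initial v) F →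
      countIn (fun i => Quotient.mk _ (a i)) (V.regionInfty F (V.initial v)) =
        matroidCorank (V.initial v) F)
    {C : Finset (Fin n)} (hC : C.card = d) (hCV : C ∉ V.baseSets) :
    tropicalMinor (fun i => (a i).1) C = ⊤ := by
  by_contra hne
  obtain ⟨ρ, hρE, hρC, -⟩ := exists_eq_tropicalMinor hne
  have hdep : V.underlying.Dep (C : Set (Fin n)) := by
    refine ⟨fun hi => hCV ?_, Set.subset_univ _⟩
    obtain ⟨S, hS, hCS⟩ := hi.exists_isBase_superset
    obtain ⟨B, rfl⟩ := S.toFinite.exists_finset_coe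
    have hB := underlying_isBase_coe.1 hS
    rwa [Finset.eq_of_subset_of_card_le (Finset.coe_subset.1 hCS)
      (by rw [card_of_mem_baseSets hB, hC])]
  obtain ⟨D, hDC, hD⟩ := hdep.exists_isCircuit_subset
  set F := V.underlying.closure D with hFdef
  have hFU : F ⊆ V.underlying.E := Set.subset_univ F
  have hDF : D ⊆ F := V.underlying.subset_closure D hD.subset_ground
  have hcyc : IsCyclicFlat V.underlying F := by
    refine (isCyclicFlat_iff_exists_isBase hFU).2
      ⟨(isFlat_iff_exists_isBase hFU).1 (V.underlying.isFlat_closure D), fun e he => ?_⟩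
    have heF : e ∈ V.underlying.closure (F \ {e}) := by
      by_cases heD : e ∈ D
      · exact V.underlying.closure_subset_closure (Set.sdiff_subset_sdiff_left hDF)
          (hD.mem_closure_sdiff_singleton_of_mem heD)
      · exact V.underlying.closure_subset_closure
          (Set.subset_sdiff_singleton hDF heD) he
    exact exists_isBase_notMem_inter_isBasis hFU
      (V.underlying.closure_subset_closure (Set.sdiff_subset_sdiff_left hFU) heF) fun _ => heF
  obtain ⟨v, hconn, hFv, B, hBv, hBK⟩ := exists_connected_isCyclicFlat hV hcyc
  have hBs := (mem_initialSets.1 hBv).1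
  have hBvF : (V.initial v).IsBasis ((B : Set (Fin n)) ∩ F) F :=
    (isBasis_inter_iff_mem_argMin hBv).2 (mem_argMin.2 ⟨hBv, fun B' hB' =>
      (mem_argMin.1 hBK).2 B' (mem_initialSets.1 hB').1⟩)
  have hcount := h v hconn F hFv
  rw [matroidCorank_eq_encard (initial_isBase_coe.2 hBv) hBvF] at hcount
  -- The cork(F) rows in R_∞ are infinite on F, so ρ matches them into C \ F.
  have hle : ((B : Set (Fin n)) \ F).encard ≤ ((C : Set (Fin n)) \ F).encard := by
    rw [← hcount, ← encard_setOf_notMem_eq (injective_of_image_eq hρC hC) hρC]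
    refine Set.encard_le_encard fun i hi hiF => hρE i ?_
    exact eq_top_of_mem_regionInfty (fun t ht => initial_eq_restrictSumContract
      (initialSets_add_of_mem_argMin _ ht hBv hBK)) hi hiF
  rw [← (Set.toFinite ((B : Set (Fin n)) \ F)).cast_ncard_eq,
    ← (Set.toFinite ((C : Set (Fin n)) \ F)).cast_ncard_eq, Nat.cast_le] at hle
  have h1 := Set.ncard_inter_add_ncard_sdiff_eq_ncard (B : Set (Fin n)) F
  have h2 := Set.ncard_inter_add_ncard_sdiff_eq_ncard (C : Set (Fin n)) F
  rw [Set.ncard_coe_finset, card_of_mem_baseSets hBs] at h1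
  rw [Set.ncard_coe_finset, hC] at h2
  have h3 := hD.eRk_add_one_eq
  have h4 := ((underlying_isBasis_inter_iff_mem_argMin hBs).2 hBK).encard_eq_eRk
  rw [← V.underlying.eRk_closure_eq, ← hFdef, ← h4,
    ← (Set.toFinite ((B : Set (Fin n)) ∩ F)).cast_ncard_eq, ← D.toFinite.cast_ncard_eq] at h3
  have h3 : ((B : Set (Fin n)) ∩ F).ncard + 1 = D.ncard := by exact_mod_cast h3
  have h5 := Set.ncard_le_ncard (Set.subset_inter hDC hDF) (Set.toFinite ((C : Set (Fin n)) ∩ F))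
  omega

end ValuatedMatroid

end

open TropVec ValuatedMatroid in
theorem theorem4p11 {n d : ℕ} (V : ValuatedMatroid n d)
    (hV : MatroidConnected V.underlying)
    (A : Fin d → TropProj n) (hA : ∀ i, A i ∈ V.linearSpace) :
    V.IsPresentation (Finset.univ.val.map A) ↔
      ∀ M ∈ V.initialMatroids, MatroidConnected M → ∀ v ∈ V.relintCell M,
        (∀ F, M.IsFlat F → countIn A (V.regionZero F v) ≤ matroidCorank M F) ∧
        (∀ F, IsCyclicFlat M F → countIn A (V.regionInfty F M) = matroidCorank M F) := by
  classical
  constructor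
  · rintro ⟨a, hPa, c, ha⟩ M - hM v rfl
    -- The multiset determines the points only up to order, which the counts ignore.
    have hcount : ∀ R, countIn A R = countIn (fun i => Quotient.mk _ (a i)) R := fun R => by
      rw [countIn_eq_countP, countIn_eq_countP, hPa]
    have ha' : ∀ i, (Quotient.mk _ (a i) : TropProj n) ∈ V.linearSpace := fun i => by
      have : (Quotient.mk _ (a i) : TropProj n) ∈ Finset.univ.val.map A := by
        rw [hPa]
        exact Multiset.mem_map_of_mem _ (Finset.mem_univ i)
      obtain ⟨k, -, hk⟩ := Multiset.mem_map.1 this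
      exact hk ▸ hA k
    simp only [hcount]
    refine ⟨fun F _ => countIn_regionZero_le_of_presentation ha hM F, fun F hF => le_antisymm ?_
      (le_countIn_regionInfty_of_presentation ha ha' hM hF)⟩
    refine le_trans (Set.encard_le_encard fun i hi => ?_)
      (countIn_regionZero_le_of_presentation ha hM F)
    exact V.regionInfty_subset_regionZero v F hi
  · intro h
    have hAa : A = fun i => Quotient.mk _ (A i).out := funext fun i => (Quotient.out_eq _).symm
    rw [hAa] at h
    have ha : ∀ i, (Quotient.mk _ (A i).out : TropProj n) ∈ V.linearSpace := fun i => by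
      rw [Quotient.out_eq]; exact hA i
    obtain ⟨c, hc⟩ := exists_tropicalMinor_eq_on_baseSets (a := fun i => (A i).out) hV
      fun v hv => exists_tropicalMinor_eq_of_countIn_le ha
        (h _ (initial_mem_initialMatroids_of_connected hv) hv v rfl).1
    refine ⟨fun i => (A i).out, by rw [← hAa], c, fun B hB => ?_⟩
    by_cases hBV : B ∈ V.baseSets
    · rw [hc B hBV, WithTop.coe_add, coe_valReal (mem_baseSets.1 hBV)]
    · rw [tropicalMinor_eq_top_of_countIn (a := fun i => (A i).out) hV (fun v hv =>
        (h _ (initial_mem_initialMatroids_of_connected hv) hv v rfl).2) hB hBV]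
      rw [mem_baseSets, not_not] at hBV
      rw [hBV, top_add]
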